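/- Let $\Omega\subset\mathbb{R}^3$ be a bounded Lipschitz domain, $0<T<\infty$ and $\underline a>0$. Put $U=H^1_0(\Omega)$, $H=L^2(\Omega)$, $U^*=H^{-1}(\Omega)$, $\mathcal U=L^2(0,T;U)$, $\mathcal U^*=L^2(0,T;U^*)$ and $\mathcal V=\{u\in\mathcal U:\dot u\in\mathcal U^*\}$, where $\dot u$ is the weak time derivative. Let $$X=\{\theta=(a,c,\phi,u_0)\in H^2(\Omega)\times L^2(\Omega)\times H^{-1}(\Omega)\times L^2(\Omega): a\ge\underline a \text{ a.e. in }\Omega\}.$$ Let $\Phi:U\to U^*$ induce a Nemytskii operator $\mathcal V\to\mathcal U^*$, $[\Phi(u)](t)=\Phi(u(t))$, and suppose that for all $u,v\in U$ (a) $\|\Phi(u)-\Phi(v)\|_{U^*}\le L_\Phi\|u-v\|_H$ with some constant $L_\Phi\ge 0$, or (b) $\langle\Phi(u)-\Phi(v),u-v\rangle_{U^*,U}+M_\Phi\|u-v\|_H^2\ge 0$ with some constant $M_\Phi\ge 0$. For $\theta=(a,c,\phi,u_0)\in X$ and $u\in\mathcal V$ let $$F_\theta(u)=\big(\dot u-\nabla\cdot(a\nabla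 u)+cu+\Phi(u)-\phi,\ u_0-u|_{t=0}\big),$$ where $u|_{t=0}$ is the value at $0$ of the representative of $u$ in $C([0,T];H)$. Then $F_\theta$ is a well-defined map $\mathcal V\to\mathcal U^*\times H$ for every $\theta\in X$. Moreover, for every $\theta^\dagger\in X$ and every radius $R$ there is a constant $C_{coe}>0$ such that $$\|u-v\|_{\mathcal U}\le C_{coe}\,\|F_\theta(u)-F_\theta(v)\|_{\mathcal U^*\times H}\qquad\text{for all }u,v\in\mathcal V\text{ and all }\theta\in X\text{ with }\|\theta-\theta^\dagger\|\le R.$$ -/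

import Mathlib

open MeasureTheory Set
open scoped ContDiff Gradient

namespace ParabolicModel

noncomputable section

/-! ### Domains -/

/-- Euclidean space `ℝ³`. -/
abbrev E3 : Type := EuclideanSpace ℝ (Fin 3)

/-- A bounded Lipschitz domain in `ℝ³`: a nonempty, connected, bounded open set which near every
boundary point is, after a rigid change of coordinates `e`, the strict epigraph of a Lipschitz
function of the first two coordinates. -/
structure IsBoundedLipschitzDomain (Ω : Set E3) : Prop where
  isOpen : IsOpen Ω
  isConnected : IsConnected Ω
  isBounded : Bornology.IsBounded Ω
  lipschitz_boundary : ∀ p ∈ frontier Ω,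
    ∃ (e : E3 ≃ₗᵢ[ℝ] E3) (g : EuclideanSpace ℝ (Fin 2) → ℝ) (K : NNReal) (r : ℝ),
      LipschitzWith K g ∧ 0 < r ∧
        ∀ x ∈ Metric.ball p r, x ∈ Ω ↔ g !₂[e x 0, e x 1] < e x 2

/-! ### Spatial function spaces -/

/-- Test functions `C_c^∞(Ω)`. -/
def IsTestFunction {V : Type} [NormedAddCommGroup V] [NormedSpace ℝ V]
    (Ω : Set V) (ψ : V → ℝ) : Prop :=
  ContDiff ℝ ∞ ψ ∧ HasCompactSupport ψ ∧ tsupport ψ ⊆ Ω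

/-- `H = L²(Ω)`. -/
abbrev L2 (Ω : Set E3) : Type := Lp ℝ 2 (volume.restrict Ω)

/-- `L²(Ω; ℝ³)`. -/
abbrev L2vec (Ω : Set E3) : Type := Lp E3 2 (volume.restrict Ω)

/-- The Hilbert space `L²(Ω) × L²(Ω; ℝ³)`, whose norm is `(‖u‖² + ‖g‖²)^(1/2)`. -/
abbrev L2Pair (Ω : Set E3) : Type := WithLp 2 (L2 Ω × L2vec Ω)

/-- The pairs `(ψ, ∇ψ)` with `ψ ∈ C_c^∞(Ω)`. -/
def testPairs (Ω : Set E3) : Set (L2Pair Ω) :=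
  {p | ∃ ψ : E3 → ℝ, IsTestFunction Ω ψ ∧
    p.fst =ᵐ[volume.restrict Ω] ψ ∧ p.snd =ᵐ[volume.restrict Ω] ∇ ψ}

/-- `U = H¹₀(Ω)`, the closure of `C_c^∞(Ω)` in the `H¹` norm; an element is stored as the pair
`(u, ∇u)`, and the norm is `(‖u‖²_{L²} + ‖∇u‖²_{L²})^(1/2)`. (The set `testPairs Ω` is already a
linear subspace, so taking its span changes nothing.) -/
def H10 (Ω : Set E3) : Submodule ℝ (L2Pair Ω) :=
  (Submodule.span ℝ (testPairs Ω)).topologicalClosure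

/-- The embedding `U → H`. -/
def toH {Ω : Set E3} (u : H10 Ω) : L2 Ω := (u : L2Pair Ω).fst

/-- The weak gradient of an element of `U`. -/
def grad {Ω : Set E3} (u : H10 Ω) : L2vec Ω := (u : L2Pair Ω).snd

/-- `U* = H⁻¹(Ω)`, the dual of `U` with its operator norm. -/
abbrev Hm1 (Ω : Set E3) : Type := H10 Ω →L[ℝ] ℝ

/-- The embedding `U → H → U*` of the Gelfand triple, `⟨u, w⟩ = ∫ u w`. -/
def gelfand {Ω : Set E3} (u : H10 Ω) : Hm1 Ω :=
  (innerSL ℝ (toH u)).comp ((WithLp.fstL 2 ℝ (L2 Ω) (L2vec Ω)).comp (H10 Ω).subtypeL)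

/-- `g` is the weak partial derivative `∂ᵢ f` on `Ω`. -/
def IsWeakPartial (Ω : Set E3) (i : Fin 3) (f g : L2 Ω) : Prop :=
  ∀ ψ : E3 → ℝ, IsTestFunction Ω ψ →
    ∫ x in Ω, f x * fderiv ℝ ψ x (EuclideanSpace.single i 1) = - ∫ x in Ω, g x * ψ x

lemma integrable_mul_of_continuous {Ω : Set E3} (f : L2 Ω) {ψ : E3 → ℝ} (hc : Continuous ψ)
    (hs : HasCompactSupport ψ) : Integrable (fun x => f x * ψ x) (volume.restrict Ω) :=
  (Lp.memLp f).integrable_mul (q := 2) (hc.memLp_of_hasCompactSupport hs)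

lemma integrable_mul_fderiv {Ω : Set E3} (f : L2 Ω) {ψ : E3 → ℝ} (hψ : IsTestFunction Ω ψ)
    (v : E3) : Integrable (fun x => f x * fderiv ℝ ψ x v) (volume.restrict Ω) :=
  integrable_mul_of_continuous f
    ((hψ.1.continuous_fderiv (by simp)).clm_apply continuous_const)
    (hψ.2.1.fderiv_apply ℝ v)

lemma IsWeakPartial.add {Ω : Set E3} {i : Fin 3} {f g f' g' : L2 Ω}
    (h : IsWeakPartial Ω i f g) (h' : IsWeakPartial Ω i f' g') :
    IsWeakPartial Ω i (f + f') (g + g') := by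
  intro ψ hψ
  have e1 : ∫ x in Ω, (f + f') x * fderiv ℝ ψ x (EuclideanSpace.single i 1) =
      ∫ x in Ω, (f x * fderiv ℝ ψ x (EuclideanSpace.single i 1) +
        f' x * fderiv ℝ ψ x (EuclideanSpace.single i 1)) := by
    refine integral_congr_ae ?_
    filter_upwards [Lp.coeFn_add f f'] with x hx
    simp only [hx, Pi.add_apply, add_mul]
  have e2 : ∫ x in Ω, (g + g') x * ψ x = ∫ x in Ω, (g x * ψ x + g' x * ψ x) := by
    refine integral_congr_ae ?_
    filter_upwards [Lp.coeFn_add g g'] with x hx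
    simp only [hx, Pi.add_apply, add_mul]
  rw [e1, e2, integral_add (integrable_mul_fderiv f hψ _) (integrable_mul_fderiv f' hψ _),
    integral_add (integrable_mul_of_continuous g hψ.1.continuous hψ.2.1)
      (integrable_mul_of_continuous g' hψ.1.continuous hψ.2.1), h ψ hψ, h' ψ hψ]
  ring

lemma IsWeakPartial.smul {Ω : Set E3} {i : Fin 3} {f g : L2 Ω} (k : ℝ)
    (h : IsWeakPartial Ω i f g) : IsWeakPartial Ω i (k • f) (k • g) := by
  intro ψ hψ
  have e1 : ∫ x in Ω, (k • f) x * fderiv ℝ ψ x (EuclideanSpace.single i 1) =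
      ∫ x in Ω, k * (f x * fderiv ℝ ψ x (EuclideanSpace.single i 1)) := by
    refine integral_congr_ae ?_
    filter_upwards [Lp.coeFn_smul k f] with x hx
    simp only [hx, Pi.smul_apply, smul_eq_mul, mul_assoc]
  have e2 : ∫ x in Ω, (k • g) x * ψ x = ∫ x in Ω, k * (g x * ψ x) := by
    refine integral_congr_ae ?_
    filter_upwards [Lp.coeFn_smul k g] with x hx
    simp only [hx, Pi.smul_apply, smul_eq_mul, mul_assoc]
  rw [e1, e2, integral_const_mul, integral_const_mul, h ψ hψ]
  ring

lemma IsWeakPartial.zero (Ω : Set E3) (i : Fin 3) : IsWeakPartial Ω i 0 0 := by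
  intro ψ _
  have h0 : ∀ χ : E3 → ℝ, ∫ x in Ω, (0 : L2 Ω) x * χ x = 0 := fun χ => by
    refine integral_eq_zero_of_ae ?_
    filter_upwards [Lp.coeFn_zero ℝ 2 (volume.restrict Ω)] with x hx
    simp only [hx, Pi.zero_apply, zero_mul]
  rw [h0, h0, neg_zero]

/-- The Hilbert space of all `(f, (fᵢ), (fᵢⱼ))` with entries in `L²(Ω)`. -/
abbrev L2Jet (Ω : Set E3) : Type :=
  WithLp 2 (L2 Ω × WithLp 2
    (PiLp 2 (fun _ : Fin 3 => L2 Ω) × PiLp 2 (fun _ : Fin 3 × Fin 3 => L2 Ω)))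

/-- `H²(Ω)`: an element is stored as `(f, (∂ᵢ f), (∂ⱼ ∂ᵢ f))`, and its norm is the `H²` norm
`(‖f‖² + ∑ᵢ ‖∂ᵢ f‖² + ∑ᵢⱼ ‖∂ⱼ ∂ᵢ f‖²)^(1/2)`. -/
def H2 (Ω : Set E3) : Submodule ℝ (L2Jet Ω) where
  carrier := {p | (∀ i, IsWeakPartial Ω i p.fst (p.snd.fst i)) ∧
    ∀ i j, IsWeakPartial Ω j (p.snd.fst i) (p.snd.snd (i, j))}
  add_mem' hp hq := ⟨fun i => (hp.1 i).add (hq.1 i), fun i j => (hp.2 i j).add (hq.2 i j)⟩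
  zero_mem' := ⟨fun i => IsWeakPartial.zero Ω i, fun _ j => IsWeakPartial.zero Ω j⟩
  smul_mem' k _ hp := ⟨fun i => (hp.1 i).smul k, fun i j => (hp.2 i j).smul k⟩

/-! ### Parameters -/

/-- The normed space `H²(Ω) × L²(Ω) × H⁻¹(Ω) × L²(Ω)` of parameters `θ = (a, c, φ, u₀)`. -/
abbrev Param (Ω : Set E3) : Type := H2 Ω × L2 Ω × Hm1 Ω × L2 Ω

namespace Param

variable {Ω : Set E3}

/-- The diffusion coefficient, as an element of `L²(Ω)`. -/
def a (θ : Param Ω) : L2 Ω := (θ.1 : L2Jet Ω).fst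

/-- The potential. -/
def c (θ : Param Ω) : L2 Ω := θ.2.1

/-- The source term. -/
def φ (θ : Param Ω) : Hm1 Ω := θ.2.2.1

/-- The initial state. -/
def u₀ (θ : Param Ω) : L2 Ω := θ.2.2.2

end Param

/-- The parameter set `X`: the diffusion coefficient satisfies `a ≥ amin` a.e. in `Ω`. -/
def paramSet (Ω : Set E3) (amin : ℝ) : Set (Param Ω) :=
  {θ | ∀ᵐ x ∂(volume.restrict Ω), amin ≤ θ.a x}

/-! ### Bochner spaces -/

/-- Lebesgue measure on `(0, T)`. -/
abbrev timeMeasure (T : ℝ) : Measure ℝ := volume.restrict (Ioo 0 T)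

/-- `𝒰 = L²(0, T; U)`. -/
abbrev StateSpace (Ω : Set E3) (T : ℝ) : Type := Lp (H10 Ω) 2 (timeMeasure T)

/-- `𝒰* = L²(0, T; U*)`. -/
abbrev DualStateSpace (Ω : Set E3) (T : ℝ) : Type := Lp (Hm1 Ω) 2 (timeMeasure T)

/-- `u'` is the weak time derivative of `u`: `∫ ψ' u dt = -∫ ψ u' dt` in `U*` for all
`ψ ∈ C_c^∞(0, T)`. -/
def IsTimeDerivative {Ω : Set E3} {T : ℝ} (u : StateSpace Ω T) (u' : DualStateSpace Ω T) : Prop :=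
  ∀ ψ : ℝ → ℝ, IsTestFunction (Ioo 0 T) ψ →
    ∫ t in Ioo 0 T, deriv ψ t • gelfand (u t) = - ∫ t in Ioo 0 T, ψ t • u' t

/-- `𝒱 = {u ∈ L²(0, T; U) : u' ∈ L²(0, T; U*)}`. -/
def smoothStates (Ω : Set E3) (T : ℝ) : Set (StateSpace Ω T) :=
  {u | ∃ u' : DualStateSpace Ω T, IsTimeDerivative u u'}

/-- `u|_{t=0} = h`: the representative of `u` in `C([0, T]; H)` has the value `h` at time `0`. -/
def HasInitialValue {Ω : Set E3} {T : ℝ} (u : StateSpace Ω T) (h : L2 Ω) : Prop :=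
  ∃ w : ℝ → L2 Ω, ContinuousOn w (Icc 0 T) ∧ (∀ᵐ t ∂(timeMeasure T), w t = toH (u t)) ∧ w 0 = h

/-! ### The model -/

/-- `ξ = -∇·(a ∇u)` in `H⁻¹(Ω)`. -/
def IsDiffusion {Ω : Set E3} (a : L2 Ω) (u : H10 Ω) (ξ : Hm1 Ω) : Prop :=
  ∀ w : H10 Ω, Integrable (fun x => a x * inner ℝ (grad u x) (grad w x)) (volume.restrict Ω) ∧
    ξ w = ∫ x in Ω, a x * inner ℝ (grad u x) (grad w x)

/-- `ξ = c u` in `H⁻¹(Ω)`. -/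
def IsPotential {Ω : Set E3} (c : L2 Ω) (u : H10 Ω) (ξ : Hm1 Ω) : Prop :=
  ∀ w : H10 Ω, Integrable (fun x => c x * toH u x * toH w x) (volume.restrict Ω) ∧
    ξ w = ∫ x in Ω, c x * toH u x * toH w x

/-- `y = (u' - ∇·(a ∇u) + c u + Φ(u) - φ, u₀ - u|_{t=0})` in `𝒰* × H`. -/
def IsPDEValue {Ω : Set E3} {T : ℝ} (Φ : H10 Ω → Hm1 Ω) (θ : Param Ω) (u : StateSpace Ω T)
    (y : DualStateSpace Ω T × L2 Ω) : Prop :=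
  (∃ u' : DualStateSpace Ω T, IsTimeDerivative u u' ∧
    ∀ᵐ t ∂(timeMeasure T), ∃ d p : Hm1 Ω, IsDiffusion θ.a (u t) d ∧ IsPotential θ.c (u t) p ∧
      y.1 t = u' t + d + p + Φ (u t) - θ.φ) ∧
  ∃ h : L2 Ω, HasInitialValue u h ∧ y.2 = θ.u₀ - h

open Classical in
/-- The PDE map `F_θ : 𝒱 → 𝒰* × H`. -/
def pdeMap {Ω : Set E3} {T : ℝ} (Φ : H10 Ω → Hm1 Ω) (θ : Param Ω) (u : StateSpace Ω T) :
    DualStateSpace Ω T × L2 Ω :=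
  if hy : ∃ y, IsPDEValue Φ θ u y then hy.choose else 0

/-- `‖Φ(u) - Φ(v)‖_{U*} ≤ L ‖u - v‖_H` for some `L ≥ 0`. -/
def IsLipschitzNonlinearity {Ω : Set E3} (Φ : H10 Ω → Hm1 Ω) : Prop :=
  ∃ L : ℝ, 0 ≤ L ∧ ∀ u v : H10 Ω, ‖Φ u - Φ v‖ ≤ L * ‖toH (u - v)‖

/-- `⟨Φ(u) - Φ(v), u - v⟩ + M ‖u - v‖_H² ≥ 0` for some `M ≥ 0`. -/
def IsMonotoneType {Ω : Set E3} (Φ : H10 Ω → Hm1 Ω) : Prop :=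
  ∃ M : ℝ, 0 ≤ M ∧ ∀ u v : H10 Ω, 0 ≤ (Φ u - Φ v) (u - v) + M * ‖toH (u - v)‖ ^ 2

/-- `Φ` induces a Nemytskii operator `𝒱 → 𝒰*`, `[Φ(u)](t) = Φ(u(t))`. -/
def InducesNemytskii {Ω : Set E3} (T : ℝ) (Φ : H10 Ω → Hm1 Ω) : Prop :=
  ∀ u ∈ smoothStates Ω T, MemLp (fun t => Φ (u t)) 2 (timeMeasure T)

end

end ParabolicModel

/-! Coercivity is the energy estimate for `w = u - v`. In the difference of the two equations the
source `φ` cancels, so `w' - ∇·(a∇w) + cw + Φ(u) - Φ(v) = f`, where `f` is the difference of the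
first components of `F_θ`; likewise `u₀` cancels, and `w(0)` is, up to sign, the difference of the
second components. Pair this with `w`. Diffusion contributes at least `amin ‖∇w‖²`. For the
potential, where `c` is only in `L²`, Hölder and the Sobolev embedding into `L⁶` give `|∫ c w²| ≤
‖c‖ ‖w‖²_{L⁴} ≤ C ‖c‖ ‖w‖^{1/2} ‖∇w‖^{3/2}` with `L²` norms on the right (`exists_eLpNorm_four_le`).
The gradient exponent is below 2, so Young's inequality absorbs the term into the diffusion at the
price of a multiple of `‖w‖_H²`. Under either assumption on `Φ` the nonlinear term is at least
`-ε‖w‖_U² - M‖w‖_H²`. This yields `dual_pairing_le`, and Gronwall's inequality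
(`integral_le_of_energy`) concludes. The constant sees `θ` only through `amin` and a bound for
`‖c‖`, which the ball around `θ†` provides.

Two facts make the argument and the map `F_θ` meaningful. First, an element of `𝒱` has a
representative in `C([0,T]; H)` with `‖w(t)‖² - ‖w(0)‖² = 2 ∫ ⟨w', w⟩`
(`exists_continuous_representative`). It is obtained by regularizing in space with resolvents `U* →
U`, for which the identity is the chain rule, and passing to the limit. Second, `-∇·(a∇u)` lies in
`H⁻¹` for every `u ∈ U` because `H²(Ω) ⊆ L^∞(Ω)` on a Lipschitz domain in `ℝ³`
(`H2.exists_ae_bound`); this comes from a second-order Taylor formula averaged over a cone inside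
`Ω`. -/

namespace ParabolicModel

open Filter Topology
open scoped ENNReal

/-! ### Absolutely continuous functions with values in a Banach space -/

section AbsolutelyContinuous

variable {E F : Type*} [NormedAddCommGroup E] [NormedAddCommGroup F]

/-- Absolute continuity only involves sums of distances, so it passes to any function with smaller
increments. This reduces vector-valued primitives to the real primitive of the norm. -/
lemma AbsolutelyContinuousOnInterval.of_dist_le {f : ℝ → E} {g : ℝ → F} {a b : ℝ}
    (hg : AbsolutelyContinuousOnInterval g a b)
    (h : ∀ s ∈ uIcc a b, ∀ t ∈ uIcc a b, dist (f s) (f t) ≤ dist (g s) (g t)) :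
    AbsolutelyContinuousOnInterval f a b := by
  refine squeeze_zero' (Eventually.of_forall fun _ => Finset.sum_nonneg fun _ _ => dist_nonneg)
    ?_ hg
  refine eventually_inf_principal.mpr (Eventually.of_forall fun I hI => ?_)
  refine Finset.sum_le_sum fun i hi => ?_
  have := hI.1 i hi
  exact h _ this.1 _ this.2

variable [NormedSpace ℝ E]

lemma absolutelyContinuousOnInterval_integral {f : ℝ → E} {a b : ℝ}
    (hf : IntervalIntegrable f volume a b) :
    AbsolutelyContinuousOnInterval (fun x => ∫ v in a..x, f v) a b := by
  refine AbsolutelyContinuousOnInterval.of_dist_le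
    (hf.norm.absolutelyContinuousOnInterval_intervalIntegral left_mem_uIcc) ?_
  intro s hs t ht
  have ha : ∀ r ∈ uIcc a b, IntervalIntegrable f volume a r := fun r hr =>
    hf.mono_set (uIcc_subset_uIcc left_mem_uIcc hr)
  rw [dist_eq_norm, dist_eq_norm,
    intervalIntegral.integral_interval_sub_left (ha s hs) (ha t ht),
    intervalIntegral.integral_interval_sub_left (ha s hs).norm (ha t ht).norm]
  exact intervalIntegral.norm_integral_le_abs_integral_norm

lemma continuousOn_primitive_const_add {f : ℝ → E} {a b : ℝ} (c : E)
    (hf : IntervalIntegrable f volume a b) :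
    ContinuousOn (fun t => c + ∫ r in a..t, f r) (uIcc a b) :=
  continuousOn_const.add (absolutelyContinuousOnInterval_integral hf).continuousOn

variable [CompleteSpace E]

/-- Fundamental theorem of calculus for an absolutely continuous function with values in a Banach
space which is differentiable almost everywhere with integrable derivative. -/
lemma integral_eq_sub_of_ae_hasDerivAt {f f' : ℝ → E} {a b : ℝ}
    (hf : AbsolutelyContinuousOnInterval f a b)
    (hd : ∀ᵐ x, x ∈ uIcc a b → HasDerivAt f (f' x) x)
    (hf' : IntervalIntegrable f' volume a b) :
    ∫ x in a..b, f' x = f b - f a := by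
  -- Subtracting the primitive of `f'` leaves an absolutely continuous function with derivative zero
  -- almost everywhere, hence a constant.
  have hac : AbsolutelyContinuousOnInterval (fun x => f x - ∫ t in a..x, f' t) a b :=
    hf.sub (absolutelyContinuousOnInterval_integral hf')
  obtain ⟨C, hC⟩ := hac.const_of_ae_hasDerivAt_zero <| by
    filter_upwards [hd, hf'.ae_hasDerivAt_integral] with x h1 h2 hx
    simpa using (h1 hx).fun_sub (h2 hx a left_mem_uIcc)
  have h1 := hC a left_mem_uIcc
  have h2 := hC b right_mem_uIcc
  simp only [intervalIntegral.integral_same, sub_zero] at h1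
  rw [← h1] at h2
  rw [← h2]; abel

end AbsolutelyContinuous

/-! ### Chain rule for the squared norm of a primitive -/

section SquaredNorm

variable {H : Type*} [NormedAddCommGroup H] [InnerProductSpace ℝ H] [CompleteSpace H]

lemma norm_sq_primitive_sub {f : ℝ → H} {a b : ℝ} (c : H)
    (hf : IntervalIntegrable f volume a b) :
    ‖c + ∫ r in a..b, f r‖ ^ 2 - ‖c‖ ^ 2 =
      ∫ t in a..b, 2 * inner ℝ (c + ∫ r in a..t, f r) (f t) := by
  set h : ℝ → H := fun t => c + ∫ r in a..t, f r with hh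
  have hcont : ContinuousOn h (uIcc a b) := continuousOn_primitive_const_add c hf
  obtain ⟨M, hM⟩ := isCompact_uIcc.exists_bound_of_continuousOn hcont
  have hM0 : 0 ≤ M := (norm_nonneg _).trans (hM a left_mem_uIcc)
  have hac : AbsolutelyContinuousOnInterval (fun t => ‖h t‖ ^ 2) a b := by
    refine AbsolutelyContinuousOnInterval.of_dist_le
      -- Since `‖h‖ ≤ M` on the interval, `|‖h s‖² - ‖h t‖²| ≤ 2M ‖h s - h t‖`.
      ((absolutelyContinuousOnInterval_integral hf).const_smul (2 * M)) ?_
    intro s hs t ht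
    have e : dist ((2 * M) • ∫ r in a..s, f r) ((2 * M) • ∫ r in a..t, f r) =
        2 * M * ‖h s - h t‖ := by
      rw [dist_eq_norm, ← smul_sub, norm_smul, Real.norm_of_nonneg (by positivity)]
      simp [hh]
    refine le_of_le_of_eq ?_ e.symm
    rw [Real.dist_eq]
    have h1 := hM s hs
    have h2 := hM t ht
    have h3 := abs_norm_sub_norm_le (h s) (h t)
    rw [sq_sub_sq, abs_mul, abs_of_nonneg (by positivity)]
    exact mul_le_mul (by linarith) h3 (abs_nonneg _) (by positivity)
  have hint : IntervalIntegrable (fun t => 2 * inner ℝ (h t) (f t)) volume a b := by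
    have hm : AEStronglyMeasurable (fun t => 2 * inner ℝ (h t) (f t))
        (volume.restrict (uIoc a b)) :=
      (((hcont.mono uIoc_subset_uIcc).aestronglyMeasurable measurableSet_uIoc).inner
        hf.aestronglyMeasurable_restrict_uIoc).const_mul 2
    refine (hf.norm.const_mul (2 * M)).mono_fun hm ?_
    refine (ae_restrict_mem measurableSet_uIoc).mono fun t ht => ?_
    have h1 := hM t (uIoc_subset_uIcc ht)
    have h2 := norm_inner_le_norm (𝕜 := ℝ) (h t) (f t)
    have h3 := mul_le_mul_of_nonneg_right h1 (norm_nonneg (f t))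
    simp only [norm_mul, norm_norm, Real.norm_ofNat, Real.norm_of_nonneg hM0]
    linarith
  have key := integral_eq_sub_of_ae_hasDerivAt hac (f' := fun t => 2 * inner ℝ (h t) (f t))
    (by
      filter_upwards [hf.ae_hasDerivAt_integral] with x hx hxm
      exact ((hx hxm a left_mem_uIcc).const_add c).norm_sq) hint
  rw [key]
  simp [hh]

end SquaredNorm

/-! ### Resolvent regularization `U* → U` -/

section Regularization

variable {U H : Type*} [NormedAddCommGroup U] [InnerProductSpace ℝ U]
  [NormedAddCommGroup H] [InnerProductSpace ℝ H]

/-- The map `U → U*` induced by a bounded operator `A : U → H`, `⟨u, w⟩ = (A u, A w)_H`. -/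
noncomputable def pullbackInner (A : U →L[ℝ] H) : U →L[ℝ] U →L[ℝ] ℝ :=
  ((ContinuousLinearMap.compL ℝ U H ℝ).flip A).comp ((innerSL ℝ).comp A)

@[simp] lemma pullbackInner_apply (A : U →L[ℝ] H) (u w : U) :
    pullbackInner A u w = inner ℝ (A u) (A w) := rfl

/-- Test the equation of `S ξ` with `S (J v)` and that of `S (J v)` with `S ξ`, where `J =
pullbackInner A`; the left sides agree by symmetry. This later moves the regularization from the
derivative `f` onto `u`. -/
lemma resolvent_symm (A : U →L[ℝ] H) {ε : ℝ} {S : (U →L[ℝ] ℝ) →L[ℝ] U}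
    (hS : ∀ ξ w, ε * inner ℝ (S ξ) w + inner ℝ (A (S ξ)) (A w) = ξ w) (ξ : U →L[ℝ] ℝ) (v : U) :
    inner ℝ (A (S ξ)) (A v) = ξ (S (pullbackInner A v)) := by
  have h1 := hS ξ (S (pullbackInner A v))
  have h2 := hS (pullbackInner A v) (S ξ)
  rw [pullbackInner_apply] at h2
  rw [← h1, real_inner_comm, ← h2, real_inner_comm (S ξ), real_inner_comm (A (S ξ))]

/-- Testing with `x - u` gives `ε (x, x - u) = -‖A(x - u)‖² ≤ 0`, hence `‖x‖² ≤ (x, u)`. The bound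
does not depend on `ε`. -/
lemma resolvent_norm_le (A : U →L[ℝ] H) {ε : ℝ} (hε : 0 < ε) {S : (U →L[ℝ] ℝ) →L[ℝ] U}
    (hS : ∀ ξ w, ε * inner ℝ (S ξ) w + inner ℝ (A (S ξ)) (A w) = ξ w) (u : U) :
    ‖S (pullbackInner A u)‖ ≤ ‖u‖ := by
  set x := S (pullbackInner A u)
  have h := hS (pullbackInner A u) (x - u)
  rw [pullbackInner_apply] at h
  change ε * inner ℝ x (x - u) + inner ℝ (A x) (A (x - u)) = _ at h
  have h2 : inner ℝ (A x) (A (x - u)) - inner ℝ (A u) (A (x - u)) = ‖A (x - u)‖ ^ 2 := by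
    rw [← inner_sub_left, ← map_sub, real_inner_self_eq_norm_sq]
  have h3 : inner ℝ x (x - u) ≤ 0 := by
    have : ε * inner ℝ x (x - u) ≤ 0 := by nlinarith [sq_nonneg ‖A (x - u)‖]
    exact nonpos_of_mul_nonpos_right this hε
  rw [inner_sub_right, real_inner_self_eq_norm_sq] at h3
  have h4 := real_inner_le_norm x u
  by_contra! hlt
  nlinarith [norm_nonneg u, norm_nonneg x]

variable [CompleteSpace U]

/-- Solution operator of `ε (x, w)_U + (A x, A w)_H = ξ w`. -/
lemma exists_resolvent (A : U →L[ℝ] H) {ε : ℝ} (hε : 0 < ε) :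
    ∃ S : (U →L[ℝ] ℝ) →L[ℝ] U,
      ∀ ξ w, ε * inner ℝ (S ξ) w + inner ℝ (A (S ξ)) (A w) = ξ w := by
  let b : U →L[ℝ] U →L[ℝ] ℝ := ε • pullbackInner (ContinuousLinearMap.id ℝ U) + pullbackInner A
  have hb : ∀ x w, b x w = ε * inner ℝ x w + inner ℝ (A x) (A w) := fun x w => by
    simp [b]
  have hc : IsCoercive b := by
    refine ⟨ε, hε, fun x => ?_⟩
    rw [hb, real_inner_self_eq_norm_sq, real_inner_self_eq_norm_sq]
    nlinarith [sq_nonneg ‖A x‖]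
  let e := hc.continuousLinearEquivOfBilin
  let J : (U →L[ℝ] ℝ) →L[ℝ] U :=
    LinearMap.mkContinuous
      { toFun := fun ξ => (InnerProductSpace.toDual ℝ U).symm ξ
        map_add' := fun ξ η => map_add _ ξ η
        map_smul' := fun k ξ => by simp } 1 fun ξ => by simp
  refine ⟨(e.symm : U →L[ℝ] U).comp J, fun ξ w => ?_⟩
  rw [← hb, ← hc.continuousLinearEquivOfBilin_apply]
  change inner ℝ (e (e.symm (J ξ))) w = _
  rw [e.apply_symm_apply]
  exact InnerProductSpace.toDual_symm_apply

variable [CompleteSpace H]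

/-- If `x` is orthogonal to the range, then `0 = (A* A x, x) = ‖A x‖²`, so `x = 0` by injectivity.
-/
lemma denseRange_adjoint_comp_self (A : U →L[ℝ] H) (hA : Function.Injective A) :
    DenseRange (fun z => A.adjoint (A z)) := by
  have h : (A.adjoint.comp A).range.topologicalClosure = ⊤ := by
    rw [Submodule.topologicalClosure_eq_top_iff, Submodule.eq_bot_iff]
    intro x hx
    have h0 : inner ℝ (A.adjoint (A x)) x = 0 :=
      (Submodule.mem_orthogonal _ _).1 hx _ ⟨x, rfl⟩
    rw [ContinuousLinearMap.adjoint_inner_left, inner_self_eq_zero] at h0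
    exact hA (by rw [h0, map_zero])
  have h2 := Submodule.dense_iff_topologicalClosure_eq_top.2 h
  simpa [DenseRange, LinearMap.coe_range, Function.comp_def] using h2

lemma exists_regularization (A : U →L[ℝ] H) (hA : Function.Injective A) :
    ∃ S : ℕ → (U →L[ℝ] ℝ) →L[ℝ] U,
      (∀ n ξ v, inner ℝ (A (S n ξ)) (A v) = ξ (S n (pullbackInner A v))) ∧
      (∀ n u, ‖S n (pullbackInner A u)‖ ≤ ‖u‖) ∧
      ∀ u, Tendsto (fun n => S n (pullbackInner A u)) atTop (𝓝 u) := by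
  have hpos : ∀ n : ℕ, (0 : ℝ) < 1 / ((n : ℝ) + 1) := fun n => by positivity
  choose S hS using fun n : ℕ => exists_resolvent A (hpos n)
  have hle : ∀ n u, ‖S n (pullbackInner A u)‖ ≤ ‖u‖ :=
    fun n u => resolvent_norm_le A (hpos n) (hS n) u
  refine ⟨S, fun n => resolvent_symm A (hS n), hle, fun u => ?_⟩
  -- On the dense range of `A* A` the regularization converges at rate `ε`; the uniform bound `hle`
  -- extends convergence to all of `U`.
  have hdense : ∀ z n, ‖S n (pullbackInner A (A.adjoint (A z))) - A.adjoint (A z)‖ ≤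
      2 * (1 / ((n : ℝ) + 1)) * ‖z‖ := by
    intro z n
    set ε := 1 / ((n : ℝ) + 1)
    have hε : 0 < ε := hpos n
    set v := A.adjoint (A z)
    set x := S n (pullbackInner A v)
    -- For `v = A* A z` the resolvent is `v - ε z` to first order, and `y` is the remainder. As `(v,
    -- y) = (A z, A y)`, the terms of order `ε` cancel and the equation tested with `y` leaves `‖y‖²
    -- ≤ ε (z, y)`.
    set y := x - v + ε • z with hy
    have h := hS n (pullbackInner A v) y
    rw [pullbackInner_apply] at h
    change ε * inner ℝ x y + inner ℝ (A x) (A y) = _ at h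
    have hv : inner ℝ v y = inner ℝ (A z) (A y) := by
      simp only [v, ContinuousLinearMap.adjoint_inner_left]
    have hx : x = y + v - ε • z := by rw [hy]; abel
    have e1 : ε * inner ℝ y y - ε * (ε * inner ℝ z y) + inner ℝ (A y) (A y) = 0 := by
      have e2 : inner ℝ x y = inner ℝ y y + inner ℝ v y - ε * inner ℝ z y := by
        conv_lhs => rw [hx]
        rw [inner_sub_left, inner_add_left, real_inner_smul_left]
      have e3 : inner ℝ (A x) (A y) =
          inner ℝ (A y) (A y) + inner ℝ (A v) (A y) - ε * inner ℝ (A z) (A y) := by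
        conv_lhs => rw [hx]
        rw [map_sub, map_add, map_smul, inner_sub_left, inner_add_left, real_inner_smul_left]
      rw [e2, e3, hv] at h
      linarith
    rw [real_inner_self_eq_norm_sq, real_inner_self_eq_norm_sq] at e1
    have h4 := real_inner_le_norm z y
    have h5 : ‖y‖ ≤ ε * ‖z‖ := by
      have h6 : ‖y‖ ^ 2 ≤ ε * inner ℝ z y := by
        have : ε * (‖y‖ ^ 2 - ε * inner ℝ z y) ≤ 0 := by nlinarith [sq_nonneg ‖A y‖]
        linarith [nonpos_of_mul_nonpos_right this hε]
      by_contra! hlt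
      nlinarith [norm_nonneg y, norm_nonneg z, mul_le_mul_of_nonneg_left h4 hε.le,
        mul_nonneg hε.le (norm_nonneg z)]
    have e4 : x - v = y - ε • z := by rw [hy]; abel
    rw [e4]
    refine (norm_sub_le _ _).trans ?_
    rw [norm_smul, Real.norm_of_nonneg hε.le]
    linarith
  rw [Metric.tendsto_atTop]
  intro δ hδ
  obtain ⟨z, hz⟩ := (denseRange_adjoint_comp_self A hA).exists_dist_lt u
    (show 0 < δ / 3 by positivity)
  have hlim : Tendsto (fun n : ℕ => 2 * (1 / ((n : ℝ) + 1)) * ‖z‖) atTop (𝓝 0) := by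
    simpa using (tendsto_one_div_add_atTop_nhds_zero_nat.const_mul (2 : ℝ)).mul_const ‖z‖
  obtain ⟨N, hN⟩ := (Metric.tendsto_atTop.1 hlim) (δ / 3) (by positivity)
  refine ⟨N, fun n hn => ?_⟩
  set v := A.adjoint (A z)
  have h1 := hle n (u - v)
  have h2 := hdense z n
  have h3 := hN n hn
  rw [Real.dist_eq, sub_zero] at h3
  have h3' := (le_abs_self _).trans_lt h3
  rw [dist_eq_norm] at hz ⊢
  have e : S n (pullbackInner A u) - u =
      S n (pullbackInner A (u - v)) + (S n (pullbackInner A v) - v) - (u - v) := by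
    simp only [map_sub]; abel
  rw [e]
  have h5 := norm_sub_le (S n (pullbackInner A (u - v)) + (S n (pullbackInner A v) - v)) (u - v)
  have h6 := norm_add_le (S n (pullbackInner A (u - v))) (S n (pullbackInner A v) - v)
  linarith

end Regularization

/-! ### Continuous representative and energy identity -/

section LionsMagenes

lemma intervalIntegrable_clm_comp {E F : Type*} [NormedAddCommGroup E] [NormedSpace ℝ E]
    [NormedAddCommGroup F] [NormedSpace ℝ F] (L : E →L[ℝ] F) {f : ℝ → E} {a b : ℝ}
    (hf : IntervalIntegrable f volume a b) :
    IntervalIntegrable (fun r => L (f r)) volume a b :=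
  ⟨L.integrable_comp hf.1, L.integrable_comp hf.2⟩

variable {U H : Type*} [NormedAddCommGroup U] [InnerProductSpace ℝ U] [CompleteSpace U]
  [NormedAddCommGroup H] [InnerProductSpace ℝ H] [CompleteSpace H]

/-- If `u ∈ L²(0, τ; U)` has the weak derivative `f ∈ L²(0, τ; U*)`, then `u` has a representative
in `C([0, τ]; H)`, and `‖u(t)‖² - ‖u(0)‖² = 2 ∫₀ᵗ ⟨f, u⟩`. -/
theorem exists_continuous_representative (A : U →L[ℝ] H) (hA : Function.Injective A) {τ : ℝ}
    (hτ : 0 < τ) {u : ℝ → U} {f : ℝ → U →L[ℝ] ℝ} (hu : MemLp u 2 (volume.restrict (Ioo 0 τ)))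
    (hf : MemLp f 2 (volume.restrict (Ioo 0 τ))) {ξ : U →L[ℝ] ℝ}
    (hW : ∀ᵐ t ∂(volume.restrict (Ioo 0 τ)), pullbackInner A (u t) = ξ + ∫ r in (0 : ℝ)..t, f r) :
    ∃ w : ℝ → H, ContinuousOn w (Icc 0 τ) ∧ (∀ᵐ t ∂(volume.restrict (Ioo 0 τ)), w t = A (u t)) ∧
      ∀ t ∈ Icc 0 τ, ‖w t‖ ^ 2 - ‖w 0‖ ^ 2 = ∫ r in (0 : ℝ)..t, 2 * f r (u r) := by
  obtain ⟨S, hsymm, hle, hlim⟩ := exists_regularization A hA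
  have hμ : volume.restrict (Ioo 0 τ) = volume.restrict (Ioc 0 τ) :=
    Measure.restrict_congr_set Ioo_ae_eq_Ioc
  rw [hμ] at hu hf hW ⊢
  set μ := volume.restrict (Ioc (0 : ℝ) τ) with hμdef
  have hfi : IntervalIntegrable f volume 0 τ :=
    (intervalIntegrable_iff_integrableOn_Ioc_of_le hτ.le).2 (hf.integrable (by norm_num))
  have hfsub : ∀ t ∈ Icc 0 τ, IntervalIntegrable f volume 0 t := fun t ht =>
    hfi.mono_set (by rw [uIcc_of_le ht.1, uIcc_of_le hτ.le]; exact Icc_subset_Icc_right ht.2)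
  have hprod : Integrable (fun r => ‖f r‖ * ‖u r‖) μ := hf.norm.integrable_mul hu.norm
  -- the regularized functions, as primitives
  let P : ((U →L[ℝ] ℝ) →L[ℝ] U) → ℝ → H :=
    fun Z t => A (Z ξ) + ∫ r in (0 : ℝ)..t, A (Z (f r))
  have hP : ∀ Z, ∀ t ∈ Icc 0 τ, P Z t = A (Z (ξ + ∫ r in (0 : ℝ)..t, f r)) := by
    intro Z t ht
    simp only [P, map_add]
    rw [← Z.intervalIntegral_comp_comm (hfsub t ht),
      ← A.intervalIntegral_comp_comm (intervalIntegrable_clm_comp Z (hfsub t ht))]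
  have hPc : ∀ Z, ContinuousOn (P Z) (Icc 0 τ) := fun Z => by
    have := continuousOn_primitive_const_add (A (Z ξ))
      (intervalIntegrable_clm_comp A (intervalIntegrable_clm_comp Z hfi))
    rwa [uIcc_of_le hτ.le] at this
  have hPsq : ∀ Z, ∀ t ∈ Icc 0 τ, ‖P Z t‖ ^ 2 - ‖P Z 0‖ ^ 2 =
      ∫ r in (0 : ℝ)..t, 2 * inner ℝ (A (Z (f r))) (A (Z (pullbackInner A (u r)))) := by
    intro Z t ht
    have h := norm_sq_primitive_sub (A (Z ξ))
      (intervalIntegrable_clm_comp A (intervalIntegrable_clm_comp Z (hfsub t ht)))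
    have h0 : P Z 0 = A (Z ξ) := by simp [P]
    rw [h0]
    refine h.trans ?_
    refine intervalIntegral.integral_congr_ae ?_
    rw [uIoc_of_le ht.1]
    filter_upwards [(ae_restrict_iff' measurableSet_Ioc).1 hW] with r hr hrt
    have hrτ : r ∈ Ioc 0 τ := ⟨hrt.1, hrt.2.trans ht.2⟩
    rw [hr hrτ, ← hP Z r ⟨hrτ.1.le, hrτ.2⟩, real_inner_comm]
  -- convergence of the regularizations
  have hmeas : ∀ n, AEStronglyMeasurable (fun r => S n (pullbackInner A (u r))) μ := fun n =>
    ((S n).comp (pullbackInner A)).continuous.comp_aestronglyMeasurable hu.1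
  let ρ : ℕ → ℝ := fun n => ∫ r in Ioc 0 τ, ‖f r‖ * ‖S n (pullbackInner A (u r)) - u r‖
  have hρm : ∀ n, AEStronglyMeasurable
      (fun r => ‖f r‖ * ‖S n (pullbackInner A (u r)) - u r‖) μ := fun n =>
    hf.1.norm.mul ((hmeas n).sub hu.1).norm
  have hρb : ∀ n r, ‖f r‖ * ‖S n (pullbackInner A (u r)) - u r‖ ≤ 2 * (‖f r‖ * ‖u r‖) := by
    intro n r
    have := norm_sub_le (S n (pullbackInner A (u r))) (u r)
    have h2 := hle n (u r)
    nlinarith [mul_le_mul_of_nonneg_left (this.trans (add_le_add_left h2 _)) (norm_nonneg (f r))]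
  have hρi : ∀ n, Integrable (fun r => ‖f r‖ * ‖S n (pullbackInner A (u r)) - u r‖) μ :=
    fun n => (hprod.const_mul 2).mono' (hρm n) (Eventually.of_forall fun r => by
      rw [Real.norm_of_nonneg (by positivity)]; exact hρb n r)
  have hρ : Tendsto ρ atTop (𝓝 0) := by
    have := tendsto_integral_of_dominated_convergence (μ := μ)
      (F := fun n r => ‖f r‖ * ‖S n (pullbackInner A (u r)) - u r‖) (f := fun _ => 0)
      (fun r => 2 * (‖f r‖ * ‖u r‖)) hρm (hprod.const_mul 2)
      (fun n => Eventually.of_forall fun r => by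
        rw [Real.norm_of_nonneg (by positivity)]; exact hρb n r)
      (Eventually.of_forall fun r => by
        simpa using ((hlim (u r)).sub_const (u r)).norm.const_mul ‖f r‖)
    simpa using this
  -- a time at which the regularizations converge
  obtain ⟨s, hs, hsW⟩ : ∃ s ∈ Ioc 0 τ, pullbackInner A (u s) = ξ + ∫ r in (0 : ℝ)..s, f r := by
    have hne : NeZero μ := ⟨by
      rw [hμdef, Ne, Measure.restrict_eq_zero, Real.volume_Ioc]; simpa using hτ⟩
    obtain ⟨s, h1, h2⟩ := (hW.and (ae_restrict_mem measurableSet_Ioc)).exists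
    exact ⟨s, h2, h1⟩
  let σ : ℕ → ℝ := fun n => ‖S n (pullbackInner A (u s)) - u s‖
  have hσ : Tendsto σ atTop (𝓝 0) := by
    simpa using ((hlim (u s)).sub_const (u s)).norm
  have hdiff : ∀ m n, ∀ t ∈ Icc 0 τ, P (S m) t - P (S n) t = P (S m - S n) t := by
    intro m n t ht
    rw [hP _ t ht, hP _ t ht, hP _ t ht, sub_apply, map_sub]
  -- Uniform Cauchy estimate: the squared norm at `t` is compared with that at the good time `s`
  -- (the `σ` terms), and both are compared with time `0` through `hPsq`, each at a cost of `4 (ρ m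
  -- + ρ n)`.
  have hbound : ∀ m n, ∀ t ∈ Icc 0 τ, ‖P (S m) t - P (S n) t‖ ^ 2 ≤
      ‖A‖ ^ 2 * (σ m + σ n) ^ 2 + 8 * (ρ m + ρ n) := by
    intro m n t ht
    rw [hdiff m n t ht]
    set Z := S m - S n
    have hZ : ∀ v, Z (pullbackInner A v) =
        (S m (pullbackInner A v) - v) - (S n (pullbackInner A v) - v) := fun v => by
      simp [Z]
    -- By symmetry the pairing is `f (Z J z)` with `z = Z J u`. The outer `Z J` has norm at most 2,
    -- while `z` itself is small because both regularizations are close to `u`.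
    have hint : ∀ r, ‖2 * inner ℝ (A (Z (f r))) (A (Z (pullbackInner A (u r))))‖ ≤
        4 * (‖f r‖ * ‖S m (pullbackInner A (u r)) - u r‖ +
          ‖f r‖ * ‖S n (pullbackInner A (u r)) - u r‖) := by
      intro r
      set z := Z (pullbackInner A (u r)) with hz
      have e : inner ℝ (A (Z (f r))) (A z) = f r (Z (pullbackInner A z)) := by
        simp only [Z, sub_apply, map_sub, inner_sub_left, hsymm]
      have h1 : ‖Z (pullbackInner A z)‖ ≤ 2 * ‖z‖ := by
        simp only [Z, sub_apply]
        have := norm_sub_le (S m (pullbackInner A z)) (S n (pullbackInner A z))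
        linarith [hle m z, hle n z]
      have h2 : ‖z‖ ≤ ‖S m (pullbackInner A (u r)) - u r‖ +
          ‖S n (pullbackInner A (u r)) - u r‖ := by
        rw [hz, hZ]; exact norm_sub_le _ _
      have h3 := (f r).le_opNorm (Z (pullbackInner A z))
      rw [e, norm_mul, Real.norm_ofNat]
      have h4 := mul_le_mul_of_nonneg_left (h1.trans (mul_le_mul_of_nonneg_left h2 zero_le_two))
        (norm_nonneg (f r))
      linarith
    have hI : ∀ t' ∈ Icc 0 τ, |‖P Z t'‖ ^ 2 - ‖P Z 0‖ ^ 2| ≤ 4 * (ρ m + ρ n) := by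
      intro t' ht'
      rw [hPsq Z t' ht', ← Real.norm_eq_abs, intervalIntegral.integral_of_le ht'.1]
      have hgi : Integrable (fun r => 4 * (‖f r‖ * ‖S m (pullbackInner A (u r)) - u r‖ +
          ‖f r‖ * ‖S n (pullbackInner A (u r)) - u r‖)) μ :=
        ((hρi m).add (hρi n)).const_mul 4
      have hsub : Ioc 0 t' ⊆ Ioc 0 τ := Ioc_subset_Ioc_right ht'.2
      refine (norm_integral_le_of_norm_le (hgi.mono_measure (Measure.restrict_mono hsub le_rfl))
        (Eventually.of_forall hint)).trans ?_
      refine (setIntegral_mono_set hgi (Eventually.of_forall fun r => by positivity)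
        (LE.le.eventuallyLE hsub)).trans ?_
      rw [integral_const_mul, integral_add (hρi m) (hρi n)]
    have hs' : s ∈ Icc 0 τ := ⟨hs.1.le, hs.2⟩
    have h1 := abs_le.1 (hI t ht)
    have h2 := abs_le.1 (hI s hs')
    have h3 : ‖P Z s‖ ≤ ‖A‖ * (σ m + σ n) := by
      rw [hP Z s hs', ← hsW]
      refine (A.le_opNorm _).trans (mul_le_mul_of_nonneg_left ?_ (norm_nonneg A))
      rw [hZ]; exact norm_sub_le _ _
    have h4 : ‖P Z s‖ ^ 2 ≤ ‖A‖ ^ 2 * (σ m + σ n) ^ 2 := by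
      rw [← mul_pow]; exact pow_le_pow_left₀ (norm_nonneg _) h3 2
    linarith [h1.1, h1.2, h2.1, h2.2]
  have hcauchy : UniformCauchySeqOn (fun n => P (S n)) atTop (Icc 0 τ) := by
    rw [Metric.uniformCauchySeqOn_iff]
    intro δ hδ
    have hlim0 : Tendsto (fun p : ℕ × ℕ => ‖A‖ ^ 2 * (σ p.1 + σ p.2) ^ 2 + 8 * (ρ p.1 + ρ p.2))
        (atTop ×ˢ atTop) (𝓝 0) := by
      have h1 := (hσ.comp tendsto_fst).add (hσ.comp (tendsto_snd (f := atTop (α := ℕ))))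
      have h2 := (hρ.comp tendsto_fst).add (hρ.comp (tendsto_snd (f := atTop (α := ℕ))))
      simpa using ((h1.pow 2).const_mul (‖A‖ ^ 2)).add (h2.const_mul 8)
    have hev := hlim0.eventually (gt_mem_nhds (show 0 < δ ^ 2 by positivity))
    rw [prod_atTop_atTop_eq, eventually_atTop_prod_self'] at hev
    obtain ⟨N, hN⟩ := hev
    refine ⟨N, fun m hm n hn t ht => ?_⟩
    rw [dist_eq_norm]
    exact lt_of_pow_lt_pow_left₀ 2 hδ.le ((hbound m n t ht).trans_lt (hN m hm n hn))
  have hex : ∀ t, ∃ y, t ∈ Icc 0 τ → Tendsto (fun n => P (S n) t) atTop (𝓝 y) := by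
    intro t
    by_cases ht : t ∈ Icc 0 τ
    · obtain ⟨y, hy⟩ := cauchySeq_tendsto_of_complete (hcauchy.cauchySeq ht)
      exact ⟨y, fun _ => hy⟩
    · exact ⟨0, fun h => absurd h ht⟩
  choose w hw using hex
  have hunif : TendstoUniformlyOn (fun n => P (S n)) w atTop (Icc 0 τ) :=
    hcauchy.tendstoUniformlyOn_of_tendsto fun t ht => hw t ht
  refine ⟨w, hunif.continuousOn (Frequently.of_forall fun n => hPc (S n)), ?_, ?_⟩
  · filter_upwards [hW, ae_restrict_mem measurableSet_Ioc] with t ht htm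
    have htm' : t ∈ Icc 0 τ := ⟨htm.1.le, htm.2⟩
    refine tendsto_nhds_unique (hw t htm') ?_
    simp_rw [hP _ t htm', ← ht]
    exact (A.continuous.tendsto _).comp (hlim (u t))
  · intro t ht
    have h0 : (0 : ℝ) ∈ Icc 0 τ := ⟨le_rfl, hτ.le⟩
    refine tendsto_nhds_unique (((hw t ht).norm.pow 2).sub ((hw 0 h0).norm.pow 2)) ?_
    -- After the symmetry the integrand is `2 f(S J S J u)`, dominated by `2 ‖f‖ ‖u‖` since each `S
    -- J` is a contraction; it converges pointwise to `2 f(u)`.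
    simp_rw [hPsq _ t ht, hsymm]
    have hsub : Ioc 0 t ⊆ Ioc 0 τ := Ioc_subset_Ioc_right ht.2
    have hle' : volume.restrict (Ioc 0 t) ≤ μ := Measure.restrict_mono hsub le_rfl
    refine intervalIntegral.tendsto_integral_filter_of_dominated_convergence
      (fun r => 2 * (‖f r‖ * ‖u r‖)) ?_ ?_ ?_ ?_
    · refine Eventually.of_forall fun n => ?_
      rw [uIoc_of_le ht.1]
      refine AEStronglyMeasurable.mono_measure ?_ hle'
      refine AEStronglyMeasurable.const_mul ?_ 2
      refine (isBoundedBilinearMap_apply (𝕜 := ℝ) (E := U)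
        (F := ℝ)).continuous.comp_aestronglyMeasurable (hf.1.prodMk ?_)
      exact ((S n).comp (pullbackInner A)).continuous.comp_aestronglyMeasurable (hmeas n)
    · refine Eventually.of_forall fun n => Eventually.of_forall fun r _ => ?_
      rw [norm_mul, Real.norm_ofNat]
      refine mul_le_mul_of_nonneg_left (((f r).le_opNorm _).trans ?_) zero_le_two
      exact mul_le_mul_of_nonneg_left ((hle n _).trans (hle n _)) (norm_nonneg _)
    · rw [intervalIntegrable_iff_integrableOn_Ioc_of_le ht.1]
      exact (hprod.const_mul 2).mono_measure hle'
    · refine Eventually.of_forall fun r _ => ?_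
      refine (((f r).continuous.tendsto _).comp ?_).const_mul 2
      have e : ∀ n, S n (pullbackInner A (S n (pullbackInner A (u r)))) =
          S n (pullbackInner A (S n (pullbackInner A (u r)) - u r)) +
            S n (pullbackInner A (u r)) := fun n => by simp only [map_sub]; abel
      have h1 : Tendsto (fun n => S n (pullbackInner A (S n (pullbackInner A (u r)) - u r)))
          atTop (𝓝 0) :=
        squeeze_zero_norm (fun n => hle n _)
          (by simpa using ((hlim (u r)).sub_const (u r)).norm)
      have h2 := h1.add (hlim (u r))
      rw [zero_add] at h2
      exact h2.congr fun n => (e n).symm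

end LionsMagenes

/-! ### Functions with an integrable weak derivative are primitives -/

section WeakTimeDerivative

variable {E : Type*} [NormedAddCommGroup E] [NormedSpace ℝ E]

lemma IsTestFunction.eq_zero_of_notMem {V : Type} [NormedAddCommGroup V] [NormedSpace ℝ V]
    {Ω : Set V} {ψ : V → ℝ} (hψ : IsTestFunction Ω ψ) {x : V} (hx : x ∉ Ω) : ψ x = 0 :=
  image_eq_zero_of_notMem_tsupport fun h => hx (hψ.2.2 h)

lemma IsTestFunction.integrable {V : Type} [NormedAddCommGroup V] [NormedSpace ℝ V]
    [MeasurableSpace V] [BorelSpace V] [FiniteDimensional ℝ V] {μ : Measure V}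
    [IsFiniteMeasureOnCompacts μ] {Ω : Set V} {ψ : V → ℝ} (hψ : IsTestFunction Ω ψ) :
    Integrable ψ μ := hψ.1.continuous.integrable_of_hasCompactSupport hψ.2.1

lemma integrable_smul_of_continuous_compact {ν : Measure ℝ} {f : ℝ → E} (hf : Integrable f ν)
    {ψ : ℝ → ℝ} (hc : Continuous ψ) (hs : HasCompactSupport ψ) :
    Integrable (fun t => ψ t • f t) ν := by
  obtain ⟨C, hC⟩ := hs.exists_bound_of_continuous hc
  exact hf.bdd_smul C hc.aestronglyMeasurable (Eventually.of_forall hC)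

variable [CompleteSpace E]

lemma exists_Icc_of_isCompact_subset_Ioo {K : Set ℝ} {a b : ℝ} (hab : a < b) (hK : IsCompact K)
    (h : K ⊆ Ioo a b) : ∃ c d, a < c ∧ d < b ∧ K ⊆ Icc c d := by
  rcases K.eq_empty_or_nonempty with rfl | hne
  · obtain ⟨c, hc⟩ := exists_between hab
    exact ⟨c, c, hc.1, hc.2, empty_subset _⟩
  · obtain ⟨c, hc⟩ := hK.exists_isLeast hne
    obtain ⟨d, hd⟩ := hK.exists_isGreatest hne
    exact ⟨c, d, (h hc.1).1, (h hd.1).2, fun x hx => ⟨hc.2 hx, hd.2 hx⟩⟩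

lemma integral_deriv_smul_primitive {f : ℝ → E} {τ : ℝ} (hτ : 0 < τ)
    (hf : IntegrableOn f (Ioo 0 τ)) {ψ : ℝ → ℝ} (hψ : IsTestFunction (Ioo 0 τ) ψ) :
    ∫ t in Ioo 0 τ, deriv ψ t • (∫ r in (0 : ℝ)..t, f r) = - ∫ t in Ioo 0 τ, ψ t • f t := by
  have hfi : IntervalIntegrable f volume 0 τ := by
    rwa [intervalIntegrable_iff_integrableOn_Ioc_of_le hτ.le, integrableOn_Ioc_iff_integrableOn_Ioo]
  set F : ℝ → E := fun t => ∫ r in (0 : ℝ)..t, f r with hF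
  have hFc : ContinuousOn F (uIcc 0 τ) :=
    (absolutelyContinuousOnInterval_integral hfi).continuousOn
  have hψac : AbsolutelyContinuousOnInterval ψ 0 τ :=
    (hψ.1.of_le (by norm_cast)).contDiffOn.absolutelyContinuousOnInterval
  have hψ' : Continuous (deriv ψ) := hψ.1.continuous_deriv (by simp)
  have i1 : IntervalIntegrable (fun t => deriv ψ t • F t) volume 0 τ :=
    (hψ'.continuousOn.smul hFc).intervalIntegrable
  have i2 : IntervalIntegrable (fun t => ψ t • f t) volume 0 τ :=
    hfi.continuousOn_smul hψ.1.continuous.continuousOn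
  have key := integral_eq_sub_of_ae_hasDerivAt
    (hψac.smul (absolutelyContinuousOnInterval_integral hfi))
    (f' := fun t => ψ t • f t + deriv ψ t • F t)
    (by
      filter_upwards [hfi.ae_hasDerivAt_integral] with x hx hxm
      exact ((hψ.1.differentiable (by simp)) x).hasDerivAt.smul (hx hxm 0 left_mem_uIcc))
    (i2.add i1)
  rw [intervalIntegral.integral_add i2 i1] at key
  simp only [Pi.smul_apply', hψ.eq_zero_of_notMem (x := 0) (by simp),
    hψ.eq_zero_of_notMem (x := τ) (by simp), zero_smul, sub_zero] at key
  rw [intervalIntegral.integral_of_le hτ.le, intervalIntegral.integral_of_le hτ.le,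
    integral_Ioc_eq_integral_Ioo, integral_Ioc_eq_integral_Ioo] at key
  exact eq_neg_of_add_eq_zero_right key

/-- Before the support of `p` the primitive vanishes trivially, beyond it because the mean of `p` is
zero; so its support stays inside the convex hull of that of `p`. -/
lemma IsTestFunction.primitive {p : ℝ → ℝ} {τ : ℝ} (hτ : 0 < τ) (hp : IsTestFunction (Ioo 0 τ) p)
    (h0 : ∫ t, p t = 0) :
    IsTestFunction (Ioo 0 τ) (fun t => ∫ r in (0 : ℝ)..t, p r) ∧
      ∀ t, deriv (fun t => ∫ r in (0 : ℝ)..t, p r) t = p t := by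
  have hd : ∀ t, HasDerivAt (fun t => ∫ r in (0 : ℝ)..t, p r) (p t) t := fun t =>
    intervalIntegral.integral_hasDerivAt_right (hp.1.continuous.intervalIntegrable _ _)
      (hp.1.continuous.stronglyMeasurableAtFilter _ _) hp.1.continuous.continuousAt
  obtain ⟨c, d, hc, hd', hK⟩ := exists_Icc_of_isCompact_subset_Ioo hτ hp.2.1 hp.2.2
  have hz : ∀ t, t ∉ Icc c d → p t = 0 := fun t ht =>
    image_eq_zero_of_notMem_tsupport fun h => ht (hK h)
  have hsupp : tsupport (fun t => ∫ r in (0 : ℝ)..t, p r) ⊆ Icc c d := by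
    refine closure_minimal (fun t ht => ?_) isClosed_Icc
    by_contra hn
    refine ht ?_
    have hsplit : t < c ∨ d < t := by
      by_contra! hh; exact hn ⟨hh.1, hh.2⟩
    rcases hsplit with h | h
    · refine intervalIntegral.integral_zero_ae (Eventually.of_forall fun r hr => hz r fun hr' => ?_)
      rcases mem_uIoc.1 hr with h' | h'
      · linarith [h'.2, hr'.1]
      · linarith [h'.2, hr'.1]
    · have hcd : 0 ≤ t := by
        by_contra! h'
        rcases (Icc c d).eq_empty_or_nonempty with he | ⟨x, hx⟩
        · refine ht ?_
          exact intervalIntegral.integral_zero_ae (Eventually.of_forall fun r hr => hz r (by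
            rw [he]; exact notMem_empty r))
        · linarith [hx.1, hx.2]
      simp only
      rw [intervalIntegral.integral_of_le hcd, setIntegral_eq_integral_of_forall_compl_eq_zero, h0]
      intro r hr
      refine hz r fun hr' => hr ⟨hc.trans_le hr'.1, hr'.2.trans h.le⟩
  refine ⟨⟨?_, HasCompactSupport.of_support_subset_isCompact isCompact_Icc
    ((subset_tsupport _).trans hsupp), hsupp.trans fun t ht => ⟨hc.trans_le ht.1,
      ht.2.trans_lt hd'⟩⟩, fun t => (hd t).deriv⟩
  rw [contDiff_infty_iff_deriv]
  refine ⟨fun t => (hd t).differentiableAt, ?_⟩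
  rw [funext fun t => (hd t).deriv]
  exact hp.1

lemma IsTestFunction.sub_const_mul {V : Type} [NormedAddCommGroup V] [NormedSpace ℝ V]
    {Ω : Set V} {φ η : V → ℝ} (hφ : IsTestFunction Ω φ) (hη : IsTestFunction Ω η) (k : ℝ) :
    IsTestFunction Ω (fun x => φ x - k * η x) := by
  have hs : tsupport (fun x => φ x - k * η x) ⊆ tsupport φ ∪ tsupport η := by
    refine closure_minimal (fun x hx => ?_) ((isClosed_tsupport _).union (isClosed_tsupport _))
    by_contra hn
    rw [mem_union, not_or] at hn
    refine hx ?_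
    simp [image_eq_zero_of_notMem_tsupport hn.1, image_eq_zero_of_notMem_tsupport hn.2]
  refine ⟨hφ.1.sub (contDiff_const.mul hη.1), ?_, hs.trans (union_subset hφ.2.2 hη.2.2)⟩
  exact (hφ.2.1.isCompact.union hη.2.1.isCompact).of_isClosed_subset (isClosed_tsupport _) hs

lemma exists_testFunction_integral_eq_one {τ : ℝ} (hτ : 0 < τ) :
    ∃ η : ℝ → ℝ, IsTestFunction (Ioo 0 τ) η ∧ ∫ t, η t = 1 := by
  let b : ContDiffBump (τ / 2) := ⟨τ / 8, τ / 4, by positivity, by linarith⟩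
  refine ⟨b.normed volume, ⟨b.contDiff_normed, b.hasCompactSupport_normed, ?_⟩,
    b.integral_normed⟩
  rw [b.tsupport_normed_eq, Real.closedBall_eq_Icc]
  intro t ht
  change t ∈ Icc (τ / 2 - τ / 4) (τ / 2 + τ / 4) at ht
  exact ⟨by linarith [ht.1], by linarith [ht.2]⟩

/-- A function with integrable weak derivative `f` on `(0, τ)` is a primitive of `f`. -/
theorem exists_ae_eq_primitive {g f : ℝ → E} {τ : ℝ} (hτ : 0 < τ)
    (hg : IntegrableOn g (Ioo 0 τ)) (hf : IntegrableOn f (Ioo 0 τ))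
    (h : ∀ ψ : ℝ → ℝ, IsTestFunction (Ioo 0 τ) ψ →
      ∫ t in Ioo 0 τ, deriv ψ t • g t = - ∫ t in Ioo 0 τ, ψ t • f t) :
    ∃ ξ : E, ∀ᵐ t ∂(volume.restrict (Ioo 0 τ)), g t = ξ + ∫ r in (0 : ℝ)..t, f r := by
  have hfi : IntervalIntegrable f volume 0 τ := by
    rwa [intervalIntegrable_iff_integrableOn_Ioc_of_le hτ.le, integrableOn_Ioc_iff_integrableOn_Ioo]
  set F : ℝ → E := fun t => ∫ r in (0 : ℝ)..t, f r with hF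
  have hFi : IntegrableOn F (Ioo 0 τ) := by
    have : ContinuousOn F (uIcc 0 τ) :=
      (absolutelyContinuousOnInterval_integral hfi).continuousOn
    rw [uIcc_of_le hτ.le] at this
    exact this.integrableOn_Icc.mono_set Ioo_subset_Icc_self
  have hk : ∀ ψ : ℝ → ℝ, IsTestFunction (Ioo 0 τ) ψ →
      ∫ t in Ioo 0 τ, deriv ψ t • (g t - F t) = 0 := by
    intro ψ hψ
    have hc : Continuous (deriv ψ) := hψ.1.continuous_deriv (by simp)
    simp_rw [smul_sub]
    rw [integral_sub (integrable_smul_of_continuous_compact hg hc hψ.2.1.deriv)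
      (integrable_smul_of_continuous_compact hFi hc hψ.2.1.deriv), h ψ hψ,
      integral_deriv_smul_primitive hτ hf hψ, sub_self]
  obtain ⟨η, hη, hη1⟩ := exists_testFunction_integral_eq_one hτ
  have hki : IntegrableOn (fun t => g t - F t) (Ioo 0 τ) := hg.sub hFi
  refine ⟨∫ t in Ioo 0 τ, η t • (g t - F t), ?_⟩
  set ξ := ∫ t in Ioo 0 τ, η t • (g t - F t) with hξ
  have hint : IntegrableOn (fun t => g t - F t - ξ) (Ioo 0 τ) :=
    hki.sub (integrableOn_const (by simp))
  have hzero := isOpen_Ioo.ae_eq_zero_of_integral_contDiff_smul_eq_zero (μ := volume)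
    (f := fun t => g t - F t - ξ) (U := Ioo 0 τ) hint.locallyIntegrableOn ?_
  · rw [ae_restrict_iff' measurableSet_Ioo]
    filter_upwards [hzero] with t ht htm
    have := ht htm
    rw [sub_sub, sub_eq_zero] at this
    rw [this, add_comm]
  · intro φ h1 h2 h3
    have hφ : IsTestFunction (Ioo 0 τ) φ := ⟨h1, h2, h3⟩
    have hset : ∫ x, φ x • (g x - F x - ξ) = ∫ x in Ioo 0 τ, φ x • (g x - F x - ξ) := by
      rw [setIntegral_eq_integral_of_forall_compl_eq_zero]
      intro x hx
      rw [hφ.eq_zero_of_notMem hx, zero_smul]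
    -- Du Bois-Reymond argument: `φ - (∫ φ) η` has mean zero, so it is the derivative of a test
    -- function and annihilates `g - F`. Hence `g - F` integrates against `φ` like the constant `ξ`.
    have hp := hφ.sub_const_mul hη (∫ t, φ t)
    obtain ⟨q1, q2⟩ := hp.primitive hτ (by
      rw [integral_sub hφ.integrable (hη.integrable.const_mul _), integral_const_mul, hη1]
      ring)
    have hq := hk _ q1
    simp_rw [q2, sub_smul, mul_smul] at hq
    have hφI : ∫ x in Ioo 0 τ, φ x = ∫ x, φ x :=
      setIntegral_eq_integral_of_forall_compl_eq_zero fun x hx => hφ.eq_zero_of_notMem hx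
    rw [integral_sub (integrable_smul_of_continuous_compact hki h1.continuous h2)
      ((integrable_smul_of_continuous_compact hki hη.1.continuous hη.2.1).fun_smul _),
      integral_smul, sub_eq_zero] at hq
    rw [hset]
    simp_rw [smul_sub _ (g _ - F _) ξ]
    rw [integral_sub (integrable_smul_of_continuous_compact hki h1.continuous h2)
      (hφ.integrable.smul_const ξ), hq, integral_smul_const, hφI, ← hξ, sub_self]

end WeakTimeDerivative

/-! ### Interior cones of a Lipschitz domain -/

section Cone

lemma interior_cone {Ω : Set E3} (hΩ : IsOpen Ω) {p : E3} (hp : p ∈ Ω) :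
    ∃ ρ > 0, ∃ (z₀ : E3) (κ : ℝ), 0 < κ ∧ ∀ x ∈ Metric.ball p ρ ∩ Ω,
      ∀ z ∈ Metric.closedBall z₀ κ, ∀ r ∈ Icc (0 : ℝ) 1, x + r • z ∈ Ω := by
  obtain ⟨ε, hε, h⟩ := Metric.isOpen_iff.1 hΩ p hp
  refine ⟨ε / 2, by positivity, 0, ε / 2, by positivity, fun x hx z hz r hr => h ?_⟩
  rw [Metric.mem_ball, dist_eq_norm]
  have h1 : ‖x - p‖ < ε / 2 := by simpa [dist_eq_norm] using hx.1
  have h2 : ‖z‖ ≤ ε / 2 := by simpa using hz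
  have h3 : ‖r • z‖ ≤ ε / 2 := by
    rw [norm_smul, Real.norm_of_nonneg hr.1]
    nlinarith [norm_nonneg z, hr.2]
  calc ‖x + r • z - p‖ = ‖(x - p) + r • z‖ := by congr 1; abel
    _ ≤ ‖x - p‖ + ‖r • z‖ := norm_add_le _ _
    _ < ε := by linarith

lemma norm_pair_le (x : E3) : ‖(!₂[x 0, x 1] : EuclideanSpace ℝ (Fin 2))‖ ≤ ‖x‖ := by
  rw [EuclideanSpace.norm_eq, EuclideanSpace.norm_eq]
  refine Real.sqrt_le_sqrt ?_
  simp only [Fin.sum_univ_two, Fin.sum_univ_three]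
  simp
  positivity

/-- Moving from a point of the strict epigraph in a direction steeper than the Lipschitz constant
stays in the epigraph; the directions near the vertical form a ball that works for all nearby
vertices at once. -/
lemma boundary_cone {Ω : Set E3} {p : E3} {e : E3 ≃ₗᵢ[ℝ] E3} {g : EuclideanSpace ℝ (Fin 2) → ℝ}
    {K : NNReal} {r : ℝ} (hg : LipschitzWith K g) (hr : 0 < r)
    (h : ∀ x ∈ Metric.ball p r, x ∈ Ω ↔ g !₂[e x 0, e x 1] < e x 2) :
    ∃ ρ > 0, ∃ (z₀ : E3) (κ : ℝ), 0 < κ ∧ ∀ x ∈ Metric.ball p ρ ∩ Ω,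
      ∀ z ∈ Metric.closedBall z₀ κ, ∀ r ∈ Icc (0 : ℝ) 1, x + r • z ∈ Ω := by
  set s := r / 4 with hs
  have hs0 : 0 < s := by positivity
  set κ := s / (K + 1) with hκ
  have hκ0 : 0 < κ := by positivity
  have hκs : κ ≤ s := div_le_self hs0.le (by simp)
  -- The choice of `κ` balances slopes: along `t • z` the height grows by at least `t (s - κ)`, and
  -- `g` by at most `t K κ`. With `s = r / 4` one has `‖t • z‖ ≤ r / 2`, so the segment stays in the
  -- chart.
  have hKκ : K * κ + κ = s := by rw [hκ]; field_simp
  set z₀ := e.symm (EuclideanSpace.single 2 s) with hz₀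
  refine ⟨r / 2, by positivity, z₀, κ, hκ0, fun x hx z hz t ht => ?_⟩
  have hzd : ‖z - z₀‖ ≤ κ := by simpa [dist_eq_norm] using hz
  have hz₀n : ‖z₀‖ = s := by
    rw [hz₀, e.symm.norm_map]; simp [abs_of_pos hs0]
  have hzn : ‖z‖ ≤ 2 * s := by
    have := norm_le_norm_add_norm_sub' z z₀
    linarith
  have hx1 : ‖x - p‖ < r / 2 := by simpa [dist_eq_norm] using hx.1
  have hxr : x ∈ Metric.ball p r := by
    rw [Metric.mem_ball, dist_eq_norm]; linarith
  have htz : ‖t • z‖ ≤ 2 * s := by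
    rw [norm_smul, Real.norm_of_nonneg ht.1]
    nlinarith [norm_nonneg z, ht.2]
  have hxz : x + t • z ∈ Metric.ball p r := by
    rw [Metric.mem_ball, dist_eq_norm]
    calc ‖x + t • z - p‖ = ‖(x - p) + t • z‖ := by congr 1; abel
      _ ≤ ‖x - p‖ + ‖t • z‖ := norm_add_le _ _
      _ < r := by linarith
  rw [h _ hxz]
  have hxΩ := (h x hxr).1 hx.2
  set y := e (z - z₀) with hy
  have hyn : ‖y‖ ≤ κ := by rw [hy, e.norm_map]; exact hzd
  have hez : e z = y + EuclideanSpace.single 2 s := by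
    rw [hy, hz₀, map_sub, e.apply_symm_apply]; abel
  have hy2 : -κ ≤ y 2 := by
    have := (PiLp.norm_apply_le y 2).trans hyn
    exact (abs_le.1 this).1
  have hcoord : e (x + t • z) = e x + t • (y + EuclideanSpace.single 2 s) := by
    rw [map_add, map_smul, hez]
  have h2 : e (x + t • z) 2 = e x 2 + t * (y 2 + s) := by
    rw [hcoord]; simp [mul_add]
  have hl := hg.dist_le_mul !₂[e (x + t • z) 0, e (x + t • z) 1] !₂[e x 0, e x 1]
  have hd : dist (!₂[e (x + t • z) 0, e (x + t • z) 1] : EuclideanSpace ℝ (Fin 2))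
      !₂[e x 0, e x 1] ≤ t * κ := by
    have : (!₂[e (x + t • z) 0, e (x + t • z) 1] : EuclideanSpace ℝ (Fin 2)) - !₂[e x 0, e x 1] =
        t • !₂[y 0, y 1] := by
      rw [hcoord]
      ext i
      fin_cases i <;> simp
    rw [dist_eq_norm, this, norm_smul, Real.norm_of_nonneg ht.1]
    exact mul_le_mul_of_nonneg_left ((norm_pair_le y).trans hyn) ht.1
  rw [h2]
  have hl2 := (le_abs_self _).trans (hl.trans (mul_le_mul_of_nonneg_left hd K.2))
  have : t * (K * κ) ≤ t * (y 2 + s) := mul_le_mul_of_nonneg_left (by linarith) ht.1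
  linarith

/-- Local uniform cone property of Lipschitz domains. -/
lemma IsBoundedLipschitzDomain.exists_cone {Ω : Set E3} (hΩ : IsBoundedLipschitzDomain Ω) {p : E3}
    (hp : p ∈ closure Ω) :
    ∃ ρ > 0, ∃ (z₀ : E3) (κ : ℝ), 0 < κ ∧ ∀ x ∈ Metric.ball p ρ ∩ Ω,
      ∀ z ∈ Metric.closedBall z₀ κ, ∀ r ∈ Icc (0 : ℝ) 1, x + r • z ∈ Ω := by
  by_cases hpΩ : p ∈ Ω
  · exact interior_cone hΩ.isOpen hpΩ
  · obtain ⟨e, g, K, r, hg, hr, h⟩ := hΩ.lipschitz_boundary p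
      ⟨hp, by rwa [hΩ.isOpen.interior_eq]⟩
    exact boundary_cone hg hr h

end Cone

/-! ### Pointwise bound by averages over a cone -/

section PointwiseBound

/-- Integrate `(r φ' - φ)' = r φ''`. Expanding from the far end `1` puts the weight `r` on the
second derivative, which compensates the concentration of the dilated averages at the vertex. -/
lemma eq_sub_add_integral_mul_deriv2 {φ φ' φ'' : ℝ → ℝ}
    (h1 : ∀ r ∈ Icc (0 : ℝ) 1, HasDerivAt φ (φ' r) r)
    (h2 : ∀ r ∈ Icc (0 : ℝ) 1, HasDerivAt φ' (φ'' r) r) (hc : Continuous φ'') :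
    φ 0 = φ 1 - φ' 1 + ∫ r in (0 : ℝ)..1, r * φ'' r := by
  have h := intervalIntegral.integral_eq_sub_of_hasDerivAt (a := 0) (b := 1)
    (f := fun r => r * φ' r - φ r) (f' := fun r => r * φ'' r) (fun r hr => by
      rw [uIcc_of_le zero_le_one] at hr
      simpa using ((hasDerivAt_id r).fun_mul (h2 r hr)).fun_sub (h1 r hr)) ((continuous_id.mul hc).intervalIntegrable _ _)
  rw [h]; ring

lemma lintegral_comp_add_smul (F : E3 → ℝ≥0∞) (x : E3) {r : ℝ} (hr : 0 < r) :
    ∫⁻ z, F (x + r • z) = ENNReal.ofReal (r ^ 3)⁻¹ * ∫⁻ z, F z := by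
  have h1 : ∫⁻ z, F (x + r • z) = ∫⁻ z, F (x + z) ∂(Measure.map (fun z : E3 => r • z) volume) :=
    (lintegral_map_equiv (fun z : E3 => F (x + z))
      (Homeomorph.smulOfNeZero (α := E3) r hr.ne').toMeasurableEquiv).symm
  have h2 := Measure.map_addHaar_smul (volume : Measure E3) hr.ne'
  rw [h1, h2, lintegral_smul_measure, lintegral_add_left_eq_self]
  simp [abs_of_pos hr]

/-- The factor by which the `L²` norm changes under the dilation by `r` in `ℝ³`. -/
noncomputable def dilationFactor (r : ℝ) : ℝ≥0∞ := ENNReal.ofReal (r ^ 3)⁻¹ ^ (1 / 2 : ℝ)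

/-- Cauchy-Schwarz on `D`, followed by the change of variables `y = x + r z` in the `L²` norm. -/
lemma setLIntegral_enorm_comp_add_smul_le {g : E3 → ℝ} (hg : Measurable g) (D : Set E3) (x : E3)
    {r : ℝ} (hr : 0 < r) :
    ∫⁻ z in D, ‖g (x + r • z)‖ₑ ≤
      eLpNorm g 2 volume * volume D ^ (1 / 2 : ℝ) * dilationFactor r := by
  have hm : Measurable fun z : E3 => g (x + r • z) := by fun_prop
  have h1 := eLpNorm_le_eLpNorm_mul_rpow_measure_univ (p := 1) (q := 2)
    (μ := volume.restrict D) (by norm_num) hm.aestronglyMeasurable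
  rw [eLpNorm_one_eq_lintegral_enorm, Measure.restrict_apply_univ] at h1
  have h2 : eLpNorm (fun z : E3 => g (x + r • z)) 2 volume =
      dilationFactor r * eLpNorm g 2 volume := by
    rw [eLpNorm_eq_lintegral_rpow_enorm_toReal (by norm_num) (by norm_num),
      eLpNorm_eq_lintegral_rpow_enorm_toReal (by norm_num) (by norm_num),
      lintegral_comp_add_smul (fun y => ‖g y‖ₑ ^ (2 : ℝ≥0∞).toReal) x hr,
      ENNReal.mul_rpow_of_nonneg _ _ (by norm_num), dilationFactor]
    simp
  have h3 : (1 / (1 : ℝ≥0∞).toReal - 1 / (2 : ℝ≥0∞).toReal) = (1 / 2 : ℝ) := by norm_num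
  rw [h3] at h1
  refine h1.trans ?_
  calc eLpNorm (fun z : E3 => g (x + r • z)) 2 (volume.restrict D) * volume D ^ (1 / 2 : ℝ)
      ≤ eLpNorm (fun z : E3 => g (x + r • z)) 2 volume * volume D ^ (1 / 2 : ℝ) := by
        gcongr; exact Measure.restrict_le_self
    _ = _ := by rw [h2]; ring

lemma dilationFactor_one : dilationFactor 1 = 1 := by simp [dilationFactor]

/-- The integrand is `r · r^{-3/2} = r^{-1/2}`, integrable at `0`. This is where the dimension three
enters. -/
lemma lintegral_mul_dilationFactor_ne_top :
    ∫⁻ r in Ioc (0 : ℝ) 1, ENNReal.ofReal r * dilationFactor r ≠ ⊤ := by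
  have hi : IntegrableOn (fun r : ℝ => r ^ (-(1 / 2) : ℝ)) (Ioc 0 1) :=
    (intervalIntegrable_iff_integrableOn_Ioc_of_le zero_le_one).1
      (intervalIntegral.intervalIntegrable_rpow' (by norm_num))
  have he : ∫⁻ r in Ioc (0 : ℝ) 1, ENNReal.ofReal r * dilationFactor r =
      ∫⁻ r in Ioc (0 : ℝ) 1, ‖r ^ (-(1 / 2) : ℝ)‖ₑ := by
    refine setLIntegral_congr_fun measurableSet_Ioc fun r hr => ?_
    have hr0 : 0 < r := hr.1
    rw [dilationFactor, ENNReal.ofReal_rpow_of_nonneg (by positivity) (by norm_num),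
      ← ENNReal.ofReal_mul hr0.le, Real.enorm_of_nonneg (by positivity)]
    congr 1
    rw [← Real.rpow_natCast, ← Real.rpow_neg hr0.le, ← Real.rpow_mul hr0.le]
    nth_rewrite 1 [← Real.rpow_one r]
    rw [← Real.rpow_add hr0]
    norm_num
  rw [he]
  exact hi.2.ne

lemma hasDerivAt_comp_line {p : E3 → ℝ} {p' : Fin 3 → E3 → ℝ} {x z : E3} {r : ℝ}
    (h : HasFDerivAt p (∑ i, p' i (x + r • z) • EuclideanSpace.proj (𝕜 := ℝ) i) (x + r • z)) :
    HasDerivAt (fun r : ℝ => p (x + r • z)) (∑ i, z i * p' i (x + r • z)) r := by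
  have hl : HasDerivAt (fun r : ℝ => x + r • z) z r := by
    simpa using ((hasDerivAt_id r).smul_const z).const_add x
  convert! h.comp_hasDerivAt r hl using 1
  simp [sum_apply, mul_comm]

/-- A pointwise bound of a function by means over a cone of the function and of its first two
derivatives. -/
lemma volume_mul_enorm_le_of_cone {p₀ : E3 → ℝ} {p₁ : Fin 3 → E3 → ℝ}
    {p₂ : Fin 3 → Fin 3 → E3 → ℝ} (hc₀ : Continuous p₀) (hc₁ : ∀ i, Continuous (p₁ i))
    (hc₂ : ∀ i j, Continuous (p₂ i j)) {x : E3} {D : Set E3} (hD : MeasurableSet D) {m : ℝ≥0∞}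
    (hm : ∀ z ∈ D, ‖z‖ₑ ≤ m)
    (hd₀ : ∀ z ∈ D, ∀ r ∈ Icc (0 : ℝ) 1, HasFDerivAt p₀
      (∑ i, p₁ i (x + r • z) • EuclideanSpace.proj (𝕜 := ℝ) i) (x + r • z))
    (hd₁ : ∀ i, ∀ z ∈ D, ∀ r ∈ Icc (0 : ℝ) 1, HasFDerivAt (p₁ i)
      (∑ j, p₂ i j (x + r • z) • EuclideanSpace.proj (𝕜 := ℝ) j) (x + r • z))
    {B : ℝ≥0∞}
    (hB₀ : ∫⁻ z in D, ‖p₀ (x + (1 : ℝ) • z)‖ₑ ≤ B)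
    (hB₁ : ∀ i, ∫⁻ z in D, ‖p₁ i (x + (1 : ℝ) • z)‖ₑ ≤ B)
    (hB₂ : ∀ i j, ∀ r ∈ Ioc (0 : ℝ) 1, ∫⁻ z in D, ‖p₂ i j (x + r • z)‖ₑ ≤ B * dilationFactor r) :
    volume D * ‖p₀ x‖ₑ ≤ B + 3 * (m * B) +
      9 * (m * m * (B * ∫⁻ r in Ioc (0 : ℝ) 1, ENNReal.ofReal r * dilationFactor r)) := by
  have hz : ∀ z ∈ D, ∀ i, ‖z i‖ₑ ≤ m := fun z hz i => by
    refine le_trans ?_ (hm z hz)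
    rw [enorm_le_iff_norm_le]; exact PiLp.norm_apply_le z i
  -- Taylor's formula along the segment from `x` to `x + z`; averaging it over `z ∈ D` gives the
  -- claim.
  have hpt : ∀ z ∈ D, ‖p₀ x‖ₑ ≤ ‖p₀ (x + (1 : ℝ) • z)‖ₑ + ∑ i, m * ‖p₁ i (x + (1 : ℝ) • z)‖ₑ +
      ∑ i, ∑ j, m * m * ∫⁻ r in Ioc (0 : ℝ) 1, ENNReal.ofReal r * ‖p₂ i j (x + r • z)‖ₑ := by
    intro z hzD
    have hcont : ∀ i j, Continuous fun r : ℝ => p₂ i j (x + r • z) := fun i j => by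
      have := hc₂ i j; fun_prop
    have key := eq_sub_add_integral_mul_deriv2 (φ := fun r => p₀ (x + r • z))
      (φ' := fun r => ∑ i, z i * p₁ i (x + r • z))
      (φ'' := fun r => ∑ i, z i * ∑ j, z j * p₂ i j (x + r • z))
      (fun r hr => hasDerivAt_comp_line (hd₀ z hzD r hr))
      (fun r hr => HasDerivAt.fun_sum fun i _ =>
        (hasDerivAt_comp_line (hd₁ i z hzD r hr)).const_mul (z i))
      (by fun_prop)
    simp only [zero_smul, add_zero] at key
    rw [key]
    refine (enorm_add_le _ _).trans (add_le_add ((enorm_sub_le).trans (add_le_add le_rfl ?_)) ?_)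
    · refine (enorm_sum_le _ _).trans (Finset.sum_le_sum fun i _ => ?_)
      rw [enorm_mul]
      gcongr
      exact hz z hzD i
    · have e : ∀ r : ℝ, r * ∑ i, z i * ∑ j, z j * p₂ i j (x + r • z) =
          ∑ i, ∑ j, z i * z j * (r * p₂ i j (x + r • z)) := fun r => by
        simp only [Finset.mul_sum]
        refine Finset.sum_congr rfl fun i _ => Finset.sum_congr rfl fun j _ => by ring
      simp_rw [e]
      have hi : ∀ i j, IntervalIntegrable (fun r : ℝ => z i * z j * (r * p₂ i j (x + r • z)))
          volume 0 1 := fun i j =>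
        (continuous_const.mul (continuous_id.mul (hcont i j))).intervalIntegrable _ _
      have hi' : ∀ i, IntervalIntegrable
          (fun r : ℝ => ∑ j, z i * z j * (r * p₂ i j (x + r • z))) volume 0 1 := fun i =>
        (by fun_prop : Continuous fun r : ℝ =>
          ∑ j, z i * z j * (r * p₂ i j (x + r • z))).intervalIntegrable _ _
      rw [intervalIntegral.integral_finsetSum fun i _ => hi' i]
      refine (enorm_sum_le _ _).trans (Finset.sum_le_sum fun i _ => ?_)
      rw [intervalIntegral.integral_finsetSum fun j _ => hi i j]
      refine (enorm_sum_le _ _).trans (Finset.sum_le_sum fun j _ => ?_)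
      rw [intervalIntegral.integral_const_mul, enorm_mul, enorm_mul,
        intervalIntegral.integral_of_le zero_le_one]
      gcongr
      · exact hz z hzD i
      · exact hz z hzD j
      · refine (enorm_integral_le_lintegral_enorm _).trans (le_of_eq ?_)
        refine setLIntegral_congr_fun measurableSet_Ioc fun r hr => ?_
        simp only [enorm_mul, Real.enorm_of_nonneg hr.1.le]
  have hmeas₁ : ∀ i, Measurable fun z : E3 => ‖p₁ i (x + (1 : ℝ) • z)‖ₑ := fun i => by
    have := hc₁ i
    exact (by fun_prop : Continuous fun z : E3 => ‖p₁ i (x + (1 : ℝ) • z)‖ₑ).measurable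
  have hmeas₀ : Measurable fun z : E3 => ‖p₀ (x + (1 : ℝ) • z)‖ₑ :=
    (by fun_prop : Continuous fun z : E3 => ‖p₀ (x + (1 : ℝ) • z)‖ₑ).measurable
  have hmeas₂ : ∀ i j, Measurable fun q : E3 × ℝ =>
      ENNReal.ofReal q.2 * ‖p₂ i j (x + q.2 • q.1)‖ₑ := fun i j => by
    have := (hc₂ i j).measurable
    fun_prop
  calc volume D * ‖p₀ x‖ₑ = ∫⁻ _ in D, ‖p₀ x‖ₑ := by
        rw [setLIntegral_const, mul_comm]
    _ ≤ ∫⁻ z in D, (‖p₀ (x + (1 : ℝ) • z)‖ₑ + ∑ i, m * ‖p₁ i (x + (1 : ℝ) • z)‖ₑ +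
        ∑ i, ∑ j, m * m * ∫⁻ r in Ioc (0 : ℝ) 1, ENNReal.ofReal r * ‖p₂ i j (x + r • z)‖ₑ) :=
        setLIntegral_mono' hD hpt
    _ = (∫⁻ z in D, ‖p₀ (x + (1 : ℝ) • z)‖ₑ) +
        (∑ i, m * ∫⁻ z in D, ‖p₁ i (x + (1 : ℝ) • z)‖ₑ) +
        ∑ i, ∑ j, m * m * ∫⁻ z in D, ∫⁻ r in Ioc (0 : ℝ) 1,
          ENNReal.ofReal r * ‖p₂ i j (x + r • z)‖ₑ := by
        have hmi : ∀ i j, Measurable fun z : E3 => m * m * ∫⁻ r in Ioc (0 : ℝ) 1,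
            ENNReal.ofReal r * ‖p₂ i j (x + r • z)‖ₑ := fun i j =>
          ((hmeas₂ i j).lintegral_prod_right').const_mul _
        have hm1 : Measurable fun z : E3 => ∑ i, m * ‖p₁ i (x + (1 : ℝ) • z)‖ₑ :=
          Finset.measurable_fun_sum _ fun i _ => (hmeas₁ i).const_mul _
        rw [lintegral_add_left (hmeas₀.fun_add hm1), lintegral_add_left hmeas₀,
          lintegral_finsetSum _ fun i _ => (hmeas₁ i).const_mul _,
          lintegral_finsetSum _ fun i _ => Finset.measurable_fun_sum _ fun j _ => hmi i j]
        congr 1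
        · congr 1
          exact Finset.sum_congr rfl fun i _ => lintegral_const_mul _ (hmeas₁ i)
        · refine Finset.sum_congr rfl fun i _ => ?_
          rw [lintegral_finsetSum _ fun j _ => hmi i j]
          exact Finset.sum_congr rfl fun j _ =>
            lintegral_const_mul _ (hmeas₂ i j).lintegral_prod_right'
    _ ≤ B + ∑ i : Fin 3, m * B + ∑ i : Fin 3, ∑ j : Fin 3, m * m *
        (B * ∫⁻ r in Ioc (0 : ℝ) 1, ENNReal.ofReal r * dilationFactor r) := by
        gcongr with i _ i _ j _
        · exact hB₁ i
        -- Tonelli: the average over `z` is bounded for each fixed `r` first, and only then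
        -- integrated in `r`.
        · rw [lintegral_lintegral_swap (hmeas₂ i j).aemeasurable]
          have hdm : Measurable fun r : ℝ => ENNReal.ofReal r * dilationFactor r := by
            unfold dilationFactor; fun_prop
          rw [← lintegral_const_mul _ hdm]
          refine setLIntegral_mono' measurableSet_Ioc fun r hr => ?_
          have hmr : Measurable fun z : E3 => ‖p₂ i j (x + r • z)‖ₑ := by
            have := (hc₂ i j).measurable; fun_prop
          rw [lintegral_const_mul _ hmr]
          calc _ ≤ ENNReal.ofReal r * (B * dilationFactor r) := by
                gcongr; exact hB₂ i j r hr
            _ = _ := by ring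
    _ = _ := by
        simp only [Finset.sum_const, Finset.card_univ, Fintype.card_fin, nsmul_eq_mul]
        push_cast
        ring

end PointwiseBound

/-! ### Mollification and the embedding `H²(Ω) ⊆ L^∞(Ω)` -/

section Mollification

variable {Ω : Set E3}

/-- Extension of an element of `L²(Ω)` by zero. -/
noncomputable def zeroExt (f : L2 Ω) : E3 → ℝ := Ω.indicator f

/-- Mollification of the extension by zero of an element of `L²(Ω)`. -/
noncomputable def mollify (b : ContDiffBump (0 : E3)) (f : L2 Ω) : E3 → ℝ :=
  MeasureTheory.convolution (b.normed volume) (zeroExt f) (ContinuousLinearMap.lsmul ℝ ℝ) volume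

lemma measurable_zeroExt (hΩ : IsOpen Ω) (f : L2 Ω) : Measurable (zeroExt f) :=
  (Lp.stronglyMeasurable f).measurable.indicator hΩ.measurableSet

lemma eLpNorm_zeroExt (hΩ : IsOpen Ω) (f : L2 Ω) : eLpNorm (zeroExt f) 2 volume = ‖f‖ₑ := by
  rw [zeroExt, eLpNorm_indicator_eq_eLpNorm_restrict hΩ.measurableSet, Lp.enorm_def]

lemma memLp_zeroExt (hΩ : IsOpen Ω) (f : L2 Ω) : MemLp (zeroExt f) 2 volume :=
  (memLp_indicator_iff_restrict hΩ.measurableSet).2 (Lp.memLp f)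

lemma locallyIntegrable_zeroExt (hΩ : IsOpen Ω) (f : L2 Ω) :
    LocallyIntegrable (zeroExt f) volume :=
  (memLp_zeroExt hΩ f).locallyIntegrable (by norm_num)

lemma continuous_mollify (hΩ : IsOpen Ω) (b : ContDiffBump (0 : E3)) (f : L2 Ω) :
    Continuous (mollify b f) :=
  b.hasCompactSupport_normed.continuous_convolution_left _ b.continuous_normed
    (locallyIntegrable_zeroExt hΩ f)

lemma integral_zeroExt_mul (hΩ : IsOpen Ω) (f : L2 Ω) (χ : E3 → ℝ) :
    ∫ x, zeroExt f x * χ x = ∫ x in Ω, f x * χ x := by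
  rw [← integral_indicator hΩ.measurableSet]
  refine integral_congr_ae (Eventually.of_forall fun x => ?_)
  by_cases hx : x ∈ Ω <;> simp [zeroExt, hx]

lemma mollify_apply (hΩ : IsOpen Ω) (b : ContDiffBump (0 : E3)) (f : L2 Ω) (y : E3) :
    mollify b f y = ∫ x in Ω, f x * b.normed volume (y - x) := by
  rw [mollify, convolution_eq_swap, ← integral_zeroExt_mul hΩ]
  simp [mul_comm]

lemma isTestFunction_bump (b : ContDiffBump (0 : E3)) {y : E3}
    (hy : Metric.closedBall y b.rOut ⊆ Ω) :
    IsTestFunction Ω (fun x => b.normed volume (y - x)) := by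
  have hs : tsupport (fun x => b.normed volume (y - x)) ⊆ Metric.closedBall y b.rOut := by
    refine closure_minimal (fun x hx => ?_) Metric.isClosed_closedBall
    have hx' : y - x ∈ Function.support (b.normed volume) := hx
    rw [b.support_normed_eq, mem_ball_zero_iff] at hx'
    rw [Metric.mem_closedBall, dist_comm, dist_eq_norm]
    exact hx'.le
  refine ⟨b.contDiff_normed.comp (contDiff_const.sub contDiff_id), ?_, hs.trans hy⟩
  exact (isCompact_closedBall y b.rOut).of_isClosed_subset (isClosed_tsupport _) hs

/-- The derivative falls on the kernel, and the weak derivative takes it over, since `x ↦ b (y - x)`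
is a test function on `Ω`. The support condition is essential: the extension by zero need not be
weakly differentiable across the boundary. -/
lemma hasFDerivAt_mollify (hΩ : IsOpen Ω) (b : ContDiffBump (0 : E3)) {f : L2 Ω}
    {g : Fin 3 → L2 Ω} (h : ∀ i, IsWeakPartial Ω i f (g i)) {y : E3}
    (hy : Metric.closedBall y b.rOut ⊆ Ω) :
    HasFDerivAt (mollify b f) (∑ i, mollify b (g i) y • EuclideanSpace.proj (𝕜 := ℝ) i) y := by
  have hd := b.hasCompactSupport_normed.hasFDerivAt_convolution_left
    (ContinuousLinearMap.lsmul ℝ ℝ) (b.contDiff_normed (μ := volume))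
    (locallyIntegrable_zeroExt hΩ f) y
  refine hd.congr_fderiv ?_
  have hcs : HasCompactSupport (fderiv ℝ (b.normed (volume : Measure E3))) :=
    b.hasCompactSupport_normed.fderiv ℝ
  have hcont : Continuous (fderiv ℝ (b.normed (volume : Measure E3))) :=
    (b.contDiff_normed (n := 1)).continuous_fderiv (by simp)
  have hex := hcs.convolutionExists_left ((ContinuousLinearMap.lsmul ℝ ℝ).precompL E3) hcont
    (locallyIntegrable_zeroExt hΩ f) y
  refine ContinuousLinearMap.coe_inj.1
    ((EuclideanSpace.basisFun (Fin 3) ℝ).toBasis.ext fun i => ?_)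
  have hψ := isTestFunction_bump b hy
  have e1 : ∀ x, fderiv ℝ (fun x => b.normed volume (y - x)) x (EuclideanSpace.single i 1) =
      - fderiv ℝ (b.normed volume) (y - x) (EuclideanSpace.single i 1) := by
    intro x
    have h1 : HasFDerivAt (fun x => b.normed volume (y - x))
        ((fderiv ℝ (b.normed volume) (y - x)).comp (-ContinuousLinearMap.id ℝ E3)) x :=
      ((b.contDiff_normed (n := 1)).differentiable (by simp) (y - x)).hasFDerivAt.comp x
        ((hasFDerivAt_id x).const_sub y)
    rw [h1.fderiv]
    simp
  have h2 := h i _ hψ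
  simp_rw [e1, mul_neg] at h2
  rw [integral_neg, neg_inj, ← mollify_apply hΩ] at h2
  simp only [OrthonormalBasis.coe_toBasis, EuclideanSpace.basisFun_apply,
    ContinuousLinearMap.coe_coe]
  rw [convolution_eq_swap]
  rw [ContinuousLinearMap.integral_apply hex.integrable_swap]
  have e2 : (∑ j, mollify b (g j) y • EuclideanSpace.proj (𝕜 := ℝ) j)
      (EuclideanSpace.single i (1 : ℝ)) = mollify b (g i) y := by
    simp [sum_apply]
  rw [e2, ← h2, ← integral_zeroExt_mul hΩ]
  refine integral_congr_ae (Eventually.of_forall fun x => ?_)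
  simp [mul_comm]

/-- A mollification is an average of translates with total weight one, so the bound for a single
translate survives, uniformly in `b`. -/
lemma setLIntegral_mollify_le (hΩ : IsOpen Ω) (b : ContDiffBump (0 : E3)) (f : L2 Ω) (D : Set E3)
    (x : E3) {r : ℝ} (hr : 0 < r) :
    ∫⁻ z in D, ‖mollify b f (x + r • z)‖ₑ ≤
      ‖f‖ₑ * volume D ^ (1 / 2 : ℝ) * dilationFactor r := by
  have hf := measurable_zeroExt hΩ f
  have hb : Measurable (b.normed (volume : Measure E3)) := b.continuous_normed.measurable
  have h1 : ∀ y, ‖mollify b f y‖ₑ ≤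
      ∫⁻ t, ENNReal.ofReal (b.normed volume t) * ‖zeroExt f (y - t)‖ₑ := by
    intro y
    refine (enorm_integral_le_lintegral_enorm _).trans (le_of_eq (lintegral_congr fun t => ?_))
    simp [enorm_mul, Real.enorm_of_nonneg (b.nonneg_normed t)]
  calc ∫⁻ z in D, ‖mollify b f (x + r • z)‖ₑ
      ≤ ∫⁻ z in D, ∫⁻ t, ENNReal.ofReal (b.normed volume t) * ‖zeroExt f (x + r • z - t)‖ₑ :=
        lintegral_mono fun z => h1 _
    _ = ∫⁻ t, ∫⁻ z in D, ENNReal.ofReal (b.normed volume t) * ‖zeroExt f (x + r • z - t)‖ₑ := by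
        refine lintegral_lintegral_swap (Measurable.aemeasurable ?_)
        unfold Function.uncurry
        fun_prop
    _ ≤ ∫⁻ t, ENNReal.ofReal (b.normed volume t) *
        (‖f‖ₑ * volume D ^ (1 / 2 : ℝ) * dilationFactor r) := by
        refine lintegral_mono fun t => ?_
        simp only
        rw [lintegral_const_mul _ (by fun_prop)]
        gcongr
        have := setLIntegral_enorm_comp_add_smul_le hf D (x - t) hr
        rw [eLpNorm_zeroExt hΩ] at this
        refine le_trans (le_of_eq (lintegral_congr fun z => ?_)) this
        congr 2; abel
    _ = _ := by
        rw [lintegral_mul_const _ (by fun_prop),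
          ← ofReal_integral_eq_lintegral_ofReal b.integrable_normed
            (Eventually.of_forall b.nonneg_normed), b.integral_normed]
        simp

/-- The bound on the ratio of the radii is what almost everywhere convergence of the mollifications
requires. -/
lemma exists_bumps : ∃ b : ℕ → ContDiffBump (0 : E3),
    Tendsto (fun n => (b n).rOut) atTop (𝓝 0) ∧ ∀ n, (b n).rOut ≤ 2 * (b n).rIn := by
  refine ⟨fun n => ⟨1 / ((n : ℝ) + 1), 2 * (1 / ((n : ℝ) + 1)), by positivity, ?_⟩, ?_, ?_⟩
  · have : (0 : ℝ) < 1 / ((n : ℝ) + 1) := by positivity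
    linarith
  · simpa using tendsto_one_div_add_atTop_nhds_zero_nat.const_mul (2 : ℝ)
  · intro n; exact le_rfl

/-- Local form of the embedding of `H²(Ω)` into `L^∞(Ω)`. -/
lemma H2.exists_bound_of_cone (hΩ : IsOpen Ω) (a : H2 Ω) {z₀ : E3} {κ : ℝ} (hκ : 0 < κ) :
    ∃ C : ℝ, ∀ᵐ x ∂(volume.restrict Ω), (∀ z ∈ Metric.closedBall z₀ κ, ∀ r ∈ Icc (0 : ℝ) 1,
      x + r • z ∈ Ω) → |(a : L2Jet Ω).fst x| ≤ C := by
  set f₀ : L2 Ω := (a : L2Jet Ω).fst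
  set f₁ : Fin 3 → L2 Ω := fun i => (a : L2Jet Ω).snd.fst i
  set f₂ : Fin 3 → Fin 3 → L2 Ω := fun i j => (a : L2Jet Ω).snd.snd (i, j)
  set D := Metric.closedBall z₀ κ
  set N : ℝ≥0∞ := ‖f₀‖ₑ + ∑ i, ‖f₁ i‖ₑ + ∑ i, ∑ j, ‖f₂ i j‖ₑ with hN
  have hN₀ : ‖f₀‖ₑ ≤ N := le_add_right le_self_add
  have hN₁ : ∀ i, ‖f₁ i‖ₑ ≤ N := fun i =>
    (Finset.single_le_sum (f := fun i => ‖f₁ i‖ₑ) (fun _ _ => zero_le) (Finset.mem_univ i)).trans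
      (le_add_right le_add_self)
  have hN₂ : ∀ i j, ‖f₂ i j‖ₑ ≤ N := fun i j =>
    ((Finset.single_le_sum (f := fun j => ‖f₂ i j‖ₑ) (fun _ _ => zero_le)
      (Finset.mem_univ j)).trans (Finset.single_le_sum (f := fun i => ∑ j, ‖f₂ i j‖ₑ)
      (fun _ _ => zero_le) (Finset.mem_univ i))).trans le_add_self
  have hNtop : N ≠ ⊤ := by
    simp [hN, ENNReal.sum_eq_top]
  set B : ℝ≥0∞ := N * volume D ^ (1 / 2 : ℝ) with hB
  set m : ℝ≥0∞ := ENNReal.ofReal (‖z₀‖ + κ)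
  set Q : ℝ≥0∞ := B + 3 * (m * B) +
      9 * (m * m * (B * ∫⁻ r in Ioc (0 : ℝ) 1, ENNReal.ofReal r * dilationFactor r)) with hQ
  have hDtop : volume D ≠ ⊤ := (isCompact_closedBall z₀ κ).measure_ne_top
  have hD0 : volume D ≠ 0 := (Metric.measure_closedBall_pos volume z₀ hκ).ne'
  have hBtop : B ≠ ⊤ := ENNReal.mul_ne_top hNtop (ENNReal.rpow_ne_top_of_nonneg (by norm_num) hDtop)
  have hmtop : m ≠ ⊤ := ENNReal.ofReal_ne_top
  have hQtop : Q ≠ ⊤ := by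
    have h3 := lintegral_mul_dilationFactor_ne_top
    refine ENNReal.add_ne_top.2 ⟨ENNReal.add_ne_top.2 ⟨hBtop, ?_⟩, ?_⟩
    · exact ENNReal.mul_ne_top (by norm_num) (ENNReal.mul_ne_top hmtop hBtop)
    · exact ENNReal.mul_ne_top (by norm_num) (ENNReal.mul_ne_top (ENNReal.mul_ne_top hmtop hmtop)
        (ENNReal.mul_ne_top hBtop h3))
  obtain ⟨b, hb, hb2⟩ := exists_bumps
  have hconv := ContDiffBump.ae_convolution_tendsto_right_of_locallyIntegrable (μ := volume) hb
    (Eventually.of_forall hb2) (locallyIntegrable_zeroExt hΩ f₀)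
  refine ⟨(Q / volume D).toReal, ?_⟩
  filter_upwards [ae_restrict_of_ae hconv, ae_restrict_mem hΩ.measurableSet] with x hx hxΩ hcone
  have hm : ∀ z ∈ D, ‖z‖ₑ ≤ m := fun z hz => by
    rw [← ofReal_norm]
    refine ENNReal.ofReal_le_ofReal ?_
    have h1 := norm_le_norm_add_norm_sub' z z₀
    have h2 : ‖z - z₀‖ ≤ κ := by simpa [D, dist_eq_norm] using hz
    linarith
  -- the cone with vertex `x` is a compact subset of `Ω`
  set Kx : Set E3 := (fun q : E3 × ℝ => x + q.2 • q.1) '' (D ×ˢ Icc (0 : ℝ) 1) with hKx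
  have hKc : IsCompact Kx :=
    ((isCompact_closedBall z₀ κ).prod isCompact_Icc).image (by fun_prop)
  have hKΩ : Kx ⊆ Ω := by
    rintro _ ⟨q, hq, rfl⟩
    exact hcone q.1 hq.1 q.2 hq.2
  obtain ⟨δ, hδ, hδΩ⟩ := hKc.exists_cthickening_subset_open hΩ hKΩ
  have hball : ∀ n, (b n).rOut ≤ δ → ∀ z ∈ D, ∀ r ∈ Icc (0 : ℝ) 1,
      Metric.closedBall (x + r • z) (b n).rOut ⊆ Ω := fun n hn z hz r hr =>
    ((Metric.closedBall_subset_closedBall hn).trans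
      (Metric.closedBall_subset_cthickening (show x + r • z ∈ Kx from ⟨(z, r), ⟨hz, hr⟩, rfl⟩)
        δ)).trans hδΩ
  -- How large `n` must be depends on `x` through `δ`, but the bound `Q / volume D` does not.
  have hbound : ∀ᶠ n in atTop, ‖mollify (b n) f₀ x‖ₑ ≤ Q / volume D := by
    filter_upwards [hb.eventually (ge_mem_nhds hδ)] with n hn
    rw [ENNReal.le_div_iff_mul_le (Or.inl hD0) (Or.inl hDtop), mul_comm]
    refine volume_mul_enorm_le_of_cone (p₁ := fun i => mollify (b n) (f₁ i))
      (p₂ := fun i j => mollify (b n) (f₂ i j)) (continuous_mollify hΩ _ _)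
      (fun i => continuous_mollify hΩ _ _) (fun i j => continuous_mollify hΩ _ _)
      Metric.isClosed_closedBall.measurableSet hm
      (fun z hz r hr => hasFDerivAt_mollify hΩ (b n) a.2.1 (hball n hn z hz r hr))
      (fun i z hz r hr => hasFDerivAt_mollify hΩ (b n) (a.2.2 i) (hball n hn z hz r hr))
      ?_ (fun i => ?_) (fun i j r hr => ?_)
    · refine (setLIntegral_mollify_le hΩ (b n) f₀ D x one_pos).trans ?_
      rw [dilationFactor_one, mul_one, hB]
      gcongr
    · refine (setLIntegral_mollify_le hΩ (b n) (f₁ i) D x one_pos).trans ?_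
      rw [dilationFactor_one, mul_one, hB]
      gcongr
      exact hN₁ i
    · refine (setLIntegral_mollify_le hΩ (b n) (f₂ i j) D x hr.1).trans ?_
      rw [hB]
      gcongr
      exact hN₂ i j
  have hlim : ‖zeroExt f₀ x‖ₑ ≤ Q / volume D :=
    le_of_tendsto ((continuous_enorm.tendsto _).comp hx) hbound
  have hQD : Q / volume D ≠ ⊤ := ENNReal.div_ne_top hQtop hD0
  rw [zeroExt, indicator_of_mem hxΩ] at hlim
  rw [← Real.norm_eq_abs, ← toReal_enorm]
  exact ENNReal.toReal_mono hQD hlim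

/-- `H²(Ω) ⊆ L^∞(Ω)` on a bounded Lipschitz domain in `ℝ³`. -/
theorem H2.exists_ae_bound (hΩ : IsBoundedLipschitzDomain Ω) (a : H2 Ω) :
    ∃ C : ℝ, 0 ≤ C ∧ ∀ᵐ x ∂(volume.restrict Ω), |(a : L2Jet Ω).fst x| ≤ C := by
  have hcomp : IsCompact (closure Ω) := hΩ.isBounded.isCompact_closure
  have hloc : ∀ p ∈ closure Ω, ∃ ρ > 0, ∃ C : ℝ, ∀ᵐ x ∂(volume.restrict Ω),
      x ∈ Metric.ball p ρ → |(a : L2Jet Ω).fst x| ≤ C := by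
    intro p hp
    obtain ⟨ρ, hρ, z₀, κ, hκ, hcone⟩ := hΩ.exists_cone hp
    obtain ⟨C, hC⟩ := H2.exists_bound_of_cone hΩ.isOpen a (z₀ := z₀) hκ
    refine ⟨ρ, hρ, C, ?_⟩
    filter_upwards [hC, ae_restrict_mem hΩ.isOpen.measurableSet] with x hx hxΩ hxp
    exact hx (hcone x ⟨hxp, hxΩ⟩)
  choose! ρ hρ C hC using hloc
  -- Cones exist near every point of the compact closure, so finitely many local bounds suffice.
  obtain ⟨t, htc, hcover⟩ := hcomp.elim_nhds_subcover (fun p => Metric.ball p (ρ p))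
    fun p hp => Metric.ball_mem_nhds p (hρ p hp)
  refine ⟨∑ p ∈ t, |C p|, Finset.sum_nonneg fun _ _ => abs_nonneg _, ?_⟩
  have hall : ∀ᵐ x ∂(volume.restrict Ω), ∀ p ∈ t, x ∈ Metric.ball p (ρ p) →
      |(a : L2Jet Ω).fst x| ≤ C p :=
    (ae_ball_iff t.countable_toSet).2 fun p hp => hC p (htc p hp)
  filter_upwards [hall, ae_restrict_mem hΩ.isOpen.measurableSet] with x hx hxΩ
  obtain ⟨p, hp, hxp⟩ := mem_iUnion₂.1 (hcover (subset_closure hxΩ))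
  exact (hx p hp hxp).trans ((le_abs_self _).trans
    (Finset.single_le_sum (f := fun p => |C p|) (fun _ _ => abs_nonneg _) hp))

end Mollification

/-! ### The space `H¹₀(Ω)` -/

section H10

variable {Ω : Set E3}

instance : CompleteSpace (H10 Ω) :=
  inferInstanceAs (CompleteSpace (Submodule.span ℝ (testPairs Ω)).topologicalClosure)

/-- The embedding `U → H` as a bounded operator. -/
noncomputable def toHL (Ω : Set E3) : H10 Ω →L[ℝ] L2 Ω :=
  (WithLp.fstL 2 ℝ (L2 Ω) (L2vec Ω)).comp (H10 Ω).subtypeL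

lemma toHL_apply (u : H10 Ω) : toHL Ω u = toH u := rfl

lemma norm_sq_eq (u : H10 Ω) : ‖u‖ ^ 2 = ‖toH u‖ ^ 2 + ‖grad u‖ ^ 2 :=
  WithLp.prod_norm_sq_eq_of_L2 (u : L2Pair Ω)

lemma norm_toH_le (u : H10 Ω) : ‖toH u‖ ≤ ‖u‖ :=
  le_of_sq_le_sq (by rw [norm_sq_eq]; nlinarith [sq_nonneg ‖grad u‖]) (norm_nonneg _)

lemma norm_grad_le (u : H10 Ω) : ‖grad u‖ ≤ ‖u‖ :=
  le_of_sq_le_sq (by rw [norm_sq_eq]; nlinarith [sq_nonneg ‖toH u‖]) (norm_nonneg _)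

lemma IsTestFunction.add {ψ χ : E3 → ℝ} (hψ : IsTestFunction Ω ψ) (hχ : IsTestFunction Ω χ) :
    IsTestFunction Ω (fun x => ψ x + χ x) := by
  simpa using hψ.sub_const_mul hχ (-1)

lemma IsTestFunction.zero : IsTestFunction Ω (fun _ => 0) :=
  ⟨contDiff_const, HasCompactSupport.zero, by simp [tsupport]⟩

lemma IsTestFunction.smul {ψ : E3 → ℝ} (hψ : IsTestFunction Ω ψ) (k : ℝ) :
    IsTestFunction Ω (fun x => k * ψ x) := by
  simpa using IsTestFunction.zero.sub_const_mul hψ (-k)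

lemma gradient_fun_add {ψ χ : E3 → ℝ} (hψ : Differentiable ℝ ψ) (hχ : Differentiable ℝ χ)
    (x : E3) : ∇ (fun x => ψ x + χ x) x = ∇ ψ x + ∇ χ x := by
  simp only [gradient]
  rw [fderiv_fun_add (hψ x) (hχ x), map_add]

lemma gradient_const_mul {ψ : E3 → ℝ} (hψ : Differentiable ℝ ψ) (k : ℝ) (x : E3) :
    ∇ (fun x => k * ψ x) x = k • ∇ ψ x := by
  simp only [gradient]
  rw [fderiv_const_mul (hψ x)]
  simp

lemma mem_testPairs_of_mem_span {p : L2Pair Ω} (hp : p ∈ Submodule.span ℝ (testPairs Ω)) :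
    p ∈ testPairs Ω := by
  induction hp using Submodule.span_induction with
  | mem p hp => exact hp
  | zero =>
    refine ⟨fun _ => 0, IsTestFunction.zero, Lp.coeFn_zero _ _ _, ?_⟩
    refine (Lp.coeFn_zero _ _ _).trans (Eventually.of_forall fun x => ?_)
    simp [gradient]
  | add p q _ _ hp hq =>
    obtain ⟨ψ, hψ, h1, h2⟩ := hp
    obtain ⟨χ, hχ, h3, h4⟩ := hq
    refine ⟨fun x => ψ x + χ x, hψ.add hχ, ?_, ?_⟩
    · filter_upwards [Lp.coeFn_add p.fst q.fst, h1, h3] with x hx h1 h3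
      change (p.fst + q.fst : L2 Ω) x = _
      rw [hx, Pi.add_apply, h1, h3]
    · filter_upwards [Lp.coeFn_add p.snd q.snd, h2, h4] with x hx h2 h4
      change (p.snd + q.snd : L2vec Ω) x = _
      rw [hx, Pi.add_apply, h2, h4,
        gradient_fun_add (hψ.1.differentiable (by simp)) (hχ.1.differentiable (by simp))]
  | smul k p _ hp =>
    obtain ⟨ψ, hψ, h1, h2⟩ := hp
    refine ⟨fun x => k * ψ x, hψ.smul k, ?_, ?_⟩
    · filter_upwards [Lp.coeFn_smul k p.fst, h1] with x hx h1
      change (k • p.fst : L2 Ω) x = _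
      rw [hx, Pi.smul_apply, h1, smul_eq_mul]
    · filter_upwards [Lp.coeFn_smul k p.snd, h2] with x hx h2
      change (k • p.snd : L2vec Ω) x = _
      rw [hx, Pi.smul_apply, h2, gradient_const_mul (hψ.1.differentiable (by simp))]

/-- A closed condition that holds for test functions holds on `H¹₀`. -/
lemma H10.induction_closed {P : L2Pair Ω → Prop} (hP : IsClosed {p | P p})
    (h : ∀ p ∈ testPairs Ω, P p) (u : H10 Ω) : P u := by
  have hu : (u : L2Pair Ω) ∈ closure (Submodule.span ℝ (testPairs Ω) : Set (L2Pair Ω)) := by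
    rw [← Submodule.topologicalClosure_coe]; exact u.2
  exact closure_minimal (fun p hp => h p (mem_testPairs_of_mem_span hp)) hP hu

lemma continuous_L2Pair_fst : Continuous fun p : L2Pair Ω => p.fst :=
  (WithLp.fstL 2 ℝ (L2 Ω) (L2vec Ω)).continuous

lemma continuous_L2Pair_snd : Continuous fun p : L2Pair Ω => p.snd :=
  (WithLp.sndL 2 ℝ (L2 Ω) (L2vec Ω)).continuous

/-- Integration by parts in `H¹₀`. -/
lemma H10.integral_grad (u : H10 Ω) {χ : E3 → ℝ} (hχ : IsTestFunction Ω χ)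
    (v : E3) : ∫ x in Ω, χ x * inner ℝ v (grad u x) = - ∫ x in Ω, toH u x * fderiv ℝ χ x v := by
  have hcd : Continuous fun x => fderiv ℝ χ x v :=
    (hχ.1.continuous_fderiv (by simp)).clm_apply continuous_const
  have hm1 : MemLp (fun x => χ x • v) 2 (volume.restrict Ω) :=
    (hχ.1.continuous.smul continuous_const).memLp_of_hasCompactSupport (hχ.2.1.smul_right)
  have hm2 : MemLp (fun x => fderiv ℝ χ x v) 2 (volume.restrict Ω) :=
    hcd.memLp_of_hasCompactSupport (hχ.2.1.fderiv_apply ℝ v)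
  have e1 : ∀ g : L2vec Ω, ∫ x in Ω, χ x * inner ℝ v (g x) = inner ℝ (hm1.toLp _) g := fun g => by
    rw [L2.inner_def]
    refine integral_congr_ae ?_
    filter_upwards [hm1.coeFn_toLp] with x hx
    rw [hx, real_inner_smul_left]
  have e2 : ∀ f : L2 Ω, ∫ x in Ω, f x * fderiv ℝ χ x v = inner ℝ (hm2.toLp _) f := fun f => by
    rw [L2.inner_def]
    refine integral_congr_ae ?_
    filter_upwards [hm2.coeFn_toLp] with x hx
    rw [hx]
    simp
  rw [e1, e2]
  refine H10.induction_closed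
    (P := fun p => inner ℝ (hm1.toLp _) p.snd = - inner ℝ (hm2.toLp _) p.fst)
    (isClosed_eq (continuous_const.inner continuous_L2Pair_snd)
      (continuous_const.inner continuous_L2Pair_fst).neg) ?_ u
  rintro p ⟨ψ, hψ, h1, h2⟩
  rw [← e1, ← e2]
  have hs1 : ∫ x in Ω, χ x * inner ℝ v (p.snd x) = ∫ x, χ x * fderiv ℝ ψ x v := by
    refine Eq.trans ?_ (setIntegral_eq_integral_of_forall_compl_eq_zero (s := Ω) fun x hx => by
      rw [hχ.eq_zero_of_notMem hx, zero_mul])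
    refine integral_congr_ae ?_
    filter_upwards [h2] with x hx
    rw [hx, real_inner_comm, inner_gradient_left]
  have hs2 : ∫ x in Ω, p.fst x * fderiv ℝ χ x v = ∫ x, fderiv ℝ χ x v * ψ x := by
    refine Eq.trans ?_ (setIntegral_eq_integral_of_forall_compl_eq_zero (s := Ω) fun x hx => by
      rw [hψ.eq_zero_of_notMem hx, mul_zero])
    refine integral_congr_ae ?_
    filter_upwards [h1] with x hx
    rw [hx, mul_comm]
  rw [hs1, hs2]
  have hcd' : Continuous fun x => fderiv ℝ ψ x v :=
    (hψ.1.continuous_fderiv (by simp)).clm_apply continuous_const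
  refine integral_mul_fderiv_eq_neg_fderiv_mul_of_integrable ?_ ?_ ?_
    (fun x _ => hχ.1.differentiable (by simp) x) (fun x _ => hψ.1.differentiable (by simp) x)
  · exact (hcd.mul hψ.1.continuous).integrable_of_hasCompactSupport hψ.2.1.mul_left
  · exact (hχ.1.continuous.mul hcd').integrable_of_hasCompactSupport hχ.2.1.mul_right
  · exact (hχ.1.continuous.mul hψ.1.continuous).integrable_of_hasCompactSupport hχ.2.1.mul_right

/-- Elements are pairs `(u, ∇u)`, so injectivity says that `u` determines `∇u`: if `u = 0`,
integration by parts shows that each component of the gradient vanishes against all test functions.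
-/
lemma toHL_injective (hΩ : IsOpen Ω) : Function.Injective (toHL Ω) := by
  rw [injective_iff_map_eq_zero]
  intro u hu
  rw [toHL_apply] at hu
  have hgi : ∀ v : E3, ∀ᵐ x, x ∈ Ω → inner ℝ v (grad u x) = (0 : ℝ) := by
    intro v
    have hm : MemLp (fun x => inner ℝ v (grad u x)) 2 (volume.restrict Ω) :=
      (Lp.memLp (grad u)).const_inner v
    have hli : LocallyIntegrableOn (fun x => inner ℝ v (grad u x)) Ω := by
      refine locallyIntegrableOn_of_locallyIntegrable_restrict ?_
      exact hm.locallyIntegrable (by norm_num)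
    refine hΩ.ae_eq_zero_of_integral_contDiff_smul_eq_zero hli fun χ h1 h2 h3 => ?_
    have hχ : IsTestFunction Ω χ := ⟨h1, h2, h3⟩
    rw [← setIntegral_eq_integral_of_forall_compl_eq_zero (s := Ω) fun x hx => by
      rw [hχ.eq_zero_of_notMem hx, zero_smul]]
    refine (H10.integral_grad u hχ v).trans ?_
    rw [hu, neg_eq_zero]
    refine integral_eq_zero_of_ae ?_
    filter_upwards [Lp.coeFn_zero ℝ 2 (volume.restrict Ω)] with x hx
    change (0 : L2 Ω) x * _ = _
    rw [hx, Pi.zero_apply, zero_mul]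
  have hg : grad u = 0 := by
    rw [Lp.eq_zero_iff_ae_eq_zero]
    have hall : ∀ᵐ x ∂(volume.restrict Ω), ∀ i : Fin 3,
        inner ℝ (EuclideanSpace.single i (1 : ℝ)) (grad u x) = (0 : ℝ) := by
      rw [ae_all_iff]
      intro i
      rw [ae_restrict_iff' hΩ.measurableSet]
      exact hgi _
    filter_upwards [hall] with x hx
    ext i
    have := hx i
    rw [EuclideanSpace.inner_single_left] at this
    simpa using this
  have : ‖u‖ ^ 2 = 0 := by rw [norm_sq_eq, hu, hg]; simp
  simpa using this

end H10

/-! ### Interpolation bound for the `L⁴` norm -/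

section L4

variable {Ω : Set E3}

lemma eLpNorm_restrict_of_support {F : Type*} [NormedAddCommGroup F] {f : E3 → F} {p : ℝ≥0∞}
    (hΩ : IsOpen Ω) (hf : ∀ x ∉ Ω, f x = 0) :
    eLpNorm f p (volume.restrict Ω) = eLpNorm f p volume := by
  rw [← eLpNorm_indicator_eq_eLpNorm_restrict hΩ.measurableSet]
  congr 1
  refine indicator_eq_self.2 fun x hx => ?_
  by_contra h
  exact hx (hf x h)

/-- Cauchy-Schwarz for `|f|⁴ = |f| · |f|³`. -/
lemma eLpNorm_four_rpow_le (f : E3 → ℝ) (hf : AEStronglyMeasurable f volume) :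
    eLpNorm f 4 volume ^ (4 : ℝ) ≤ eLpNorm f 2 volume * eLpNorm f 6 volume ^ (3 : ℝ) := by
  have h4 : eLpNorm f 4 volume ^ (4 : ℝ) = ∫⁻ x, ‖f x‖ₑ ^ (4 : ℝ) := by
    have := eLpNorm_nnreal_pow_eq_lintegral (f := f) (μ := volume) (p := 4) (by norm_num)
    simpa using this
  have h2 : eLpNorm f 2 volume = (∫⁻ x, ‖f x‖ₑ ^ (2 : ℝ)) ^ (1 / 2 : ℝ) := by
    rw [eLpNorm_eq_lintegral_rpow_enorm_toReal (by norm_num) (by norm_num)]; simp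
  have h6 : eLpNorm f 6 volume ^ (3 : ℝ) = (∫⁻ x, (‖f x‖ₑ ^ (3 : ℝ)) ^ (2 : ℝ)) ^ (1 / 2 : ℝ) := by
    rw [eLpNorm_eq_lintegral_rpow_enorm_toReal (by norm_num) (by norm_num), ← ENNReal.rpow_mul]
    simp_rw [← ENNReal.rpow_mul]
    norm_num
  have hH := ENNReal.lintegral_mul_le_Lp_mul_Lq volume (p := 2) (q := 2)
    (Real.HolderConjugate.two_two) (f := fun x => ‖f x‖ₑ) (g := fun x => ‖f x‖ₑ ^ (3 : ℝ))
    hf.enorm (hf.enorm.pow_const _)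
  rw [h4, h2, h6]
  refine le_trans (le_of_eq (lintegral_congr fun x => ?_)) hH
  rw [Pi.mul_apply]
  nth_rewrite 2 [← ENNReal.rpow_one ‖f x‖ₑ]
  rw [← ENNReal.rpow_add_of_nonneg _ _ zero_le_one (by norm_num)]
  norm_num

/-- For test functions the Sobolev inequality bounds the `L⁶` norm by the gradient. Keeping one
power of `‖toH u‖` under the root, instead of the full `U` norm, is what makes the potential term
absorbable. -/
lemma exists_eLpNorm_four_le (hΩ : IsOpen Ω) : ∃ K : ℝ, 0 ≤ K ∧ ∀ u : H10 Ω,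
    eLpNorm (toH u) 4 (volume.restrict Ω) ≤
      ENNReal.ofReal ((K * ‖toH u‖ * ‖grad u‖ ^ 3) ^ (1 / 4 : ℝ)) := by
  set C := SNormLESNormFDerivOfEqConst ℝ (volume : Measure E3) 2
  refine ⟨(C : ℝ) ^ 3, by positivity, fun u => ?_⟩
  refine H10.induction_closed (P := fun p => eLpNorm p.fst 4 (volume.restrict Ω) ≤
    ENNReal.ofReal (((C : ℝ) ^ 3 * ‖p.fst‖ * ‖p.snd‖ ^ 3) ^ (1 / 4 : ℝ))) ?_ ?_ u
  · have hcont : Continuous fun p : L2Pair Ω =>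
        ENNReal.ofReal (((C : ℝ) ^ 3 * ‖p.fst‖ * ‖p.snd‖ ^ 3) ^ (1 / 4 : ℝ)) := by
      refine ENNReal.continuous_ofReal.comp (Continuous.rpow_const ?_ fun _ => Or.inr (by norm_num))
      exact (continuous_const.mul continuous_L2Pair_fst.norm).mul (continuous_L2Pair_snd.norm.pow 3)
    -- The `L⁴` norm is not continuous on `L²`, but by Fatou it is lower semicontinuous along an
    -- almost everywhere convergent subsequence; the right side is continuous.
    refine IsSeqClosed.isClosed fun p q hp hpq => ?_
    have hf : Tendsto (fun n => (p n).fst) atTop (𝓝 q.fst) := (continuous_L2Pair_fst.tendsto q).comp hpq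
    obtain ⟨φ, hφ, hae⟩ := (tendstoInMeasure_of_tendsto_Lp hf).exists_seq_tendsto_ae
    refine (Lp.eLpNorm_lim_le_liminf_eLpNorm (fun n => (Lp.aestronglyMeasurable (p (φ n)).fst)) _
      hae).trans ?_
    have hlim := ((hcont.tendsto q).comp hpq).comp hφ.tendsto_atTop
    rw [← hlim.liminf_eq]
    exact liminf_le_liminf (Eventually.of_forall fun n => hp (φ n))
  · rintro p ⟨ψ, hψ, h1, h2⟩
    have e1 : eLpNorm p.fst 4 (volume.restrict Ω) = eLpNorm ψ 4 volume := by
      rw [eLpNorm_congr_ae h1, eLpNorm_restrict_of_support hΩ fun x hx => hψ.eq_zero_of_notMem hx]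
    have e2 : ENNReal.ofReal ‖p.fst‖ = eLpNorm ψ 2 volume := by
      rw [ofReal_norm, Lp.enorm_def, eLpNorm_congr_ae h1,
        eLpNorm_restrict_of_support hΩ fun x hx => hψ.eq_zero_of_notMem hx]
    have e3 : ENNReal.ofReal ‖p.snd‖ = eLpNorm (fderiv ℝ ψ) 2 volume := by
      have hz : ∀ x ∉ Ω, ∇ ψ x = 0 := fun x hx => by
        have : fderiv ℝ ψ x = 0 := image_eq_zero_of_notMem_tsupport fun h =>
          hx (hψ.2.2 (tsupport_fderiv_subset ℝ h))
        simp [gradient, this]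
      rw [ofReal_norm, Lp.enorm_def, eLpNorm_congr_ae h2, eLpNorm_restrict_of_support hΩ hz]
      refine eLpNorm_congr_norm_ae (Eventually.of_forall fun x => ?_)
      simp [gradient]
    have hsob : eLpNorm ψ 6 volume ≤ C * eLpNorm (fderiv ℝ ψ) 2 volume := by
      have := eLpNorm_le_eLpNorm_fderiv_of_eq (volume : Measure E3)
        (hψ.1.of_le (by norm_cast)) hψ.2.1 (p := 2) (p' := 6) (by norm_num) (by simp)
        (by simp; norm_num)
      exact_mod_cast this
    have h4 := eLpNorm_four_rpow_le ψ hψ.1.continuous.aestronglyMeasurable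
    have h5 : eLpNorm ψ 4 volume ^ (4 : ℝ) ≤
        ENNReal.ofReal ((C : ℝ) ^ 3 * ‖p.fst‖ * ‖p.snd‖ ^ 3) := by
      refine h4.trans ?_
      rw [ENNReal.ofReal_mul (by positivity), ENNReal.ofReal_mul (by positivity),
        ENNReal.ofReal_pow (by positivity), ENNReal.ofReal_pow (by positivity), e2, e3,
        ENNReal.ofReal_coe_nnreal]
      calc eLpNorm ψ 2 volume * eLpNorm ψ 6 volume ^ (3 : ℝ)
          ≤ eLpNorm ψ 2 volume * (C * eLpNorm (fderiv ℝ ψ) 2 volume) ^ (3 : ℝ) := by gcongr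
        _ = _ := by
            rw [show (3 : ℝ) = ((3 : ℕ) : ℝ) by norm_num, ENNReal.rpow_natCast]
            ring
    rw [e1, ← ENNReal.ofReal_rpow_of_nonneg (by positivity) (by norm_num)]
    rw [one_div, ENNReal.le_rpow_inv_iff (by norm_num)]
    exact h5

end L4

/-! ### The diffusion and potential operators -/

section Operators

variable {Ω : Set E3}

/-- A bounded symmetric bilinear form given by an integral. -/
lemma exists_clm_of_integral {U α : Type*} [NormedAddCommGroup U] [NormedSpace ℝ U]
    [MeasurableSpace α] {μ : Measure α} (k : U → U → α → ℝ) (hk : ∀ u w, Integrable (k u w) μ)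
    (hadd : ∀ u v w, k (u + v) w =ᵐ[μ] fun x => k u w x + k v w x)
    (hsmul : ∀ (r : ℝ) u w, k (r • u) w =ᵐ[μ] fun x => r * k u w x)
    (hsymm : ∀ u w, k u w =ᵐ[μ] k w u) {C : ℝ} (hC : ∀ u w, |∫ x, k u w x ∂μ| ≤ C * ‖u‖ * ‖w‖) :
    ∃ B : U →L[ℝ] U →L[ℝ] ℝ, ∀ u w, B u w = ∫ x, k u w x ∂μ := by
  have h1 : ∀ u v w, ∫ x, k (u + v) w x ∂μ = ∫ x, k u w x ∂μ + ∫ x, k v w x ∂μ := fun u v w => by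
    rw [integral_congr_ae (hadd u v w), integral_add (hk u w) (hk v w)]
  have h2 : ∀ (r : ℝ) u w, ∫ x, k (r • u) w x ∂μ = r * ∫ x, k u w x ∂μ := fun r u w => by
    rw [integral_congr_ae (hsmul r u w), integral_const_mul]
  have h3 : ∀ u w, ∫ x, k u w x ∂μ = ∫ x, k w u x ∂μ := fun u w =>
    integral_congr_ae (hsymm u w)
  -- Linearity in the second argument is deduced from the first by symmetry.
  refine ⟨LinearMap.mkContinuous₂ (LinearMap.mk₂ ℝ (fun u w => ∫ x, k u w x ∂μ) h1 h2
    (fun u v w => ?_) fun r u w => ?_) C hC, fun u w => rfl⟩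
  · rw [h3, h1, h3 v, h3 w]
  · rw [h3, h2, h3 w]; rfl

lemma toH_add_ae (u v : H10 Ω) :
    toH (u + v) =ᵐ[volume.restrict Ω] fun x => toH u x + toH v x := Lp.coeFn_add _ _

lemma toH_smul_ae (r : ℝ) (u : H10 Ω) :
    toH (r • u) =ᵐ[volume.restrict Ω] fun x => r * toH u x := Lp.coeFn_smul _ _

lemma grad_add_ae (u v : H10 Ω) :
    grad (u + v) =ᵐ[volume.restrict Ω] fun x => grad u x + grad v x := Lp.coeFn_add _ _

lemma grad_smul_ae (r : ℝ) (u : H10 Ω) :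
    grad (r • u) =ᵐ[volume.restrict Ω] fun x => r • grad u x := Lp.coeFn_smul _ _

lemma integrable_diffusion {a : L2 Ω} {C : ℝ}
    (ha : ∀ᵐ x ∂(volume.restrict Ω), |a x| ≤ C) (g h : L2vec Ω) :
    Integrable (fun x => a x * inner ℝ (g x) (h x)) (volume.restrict Ω) :=
  (L2.integrable_inner (𝕜 := ℝ) g h).bdd_mul (c := C) (Lp.aestronglyMeasurable a) ha

/-- The bound of `A` may depend on `θ`: the operator only has to exist, and the estimates use the
lower bound of `a`. -/
lemma exists_diffusion (hΩ : IsBoundedLipschitzDomain Ω) (θ : Param Ω) :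
    ∃ A : H10 Ω →L[ℝ] Hm1 Ω, ∀ u, IsDiffusion θ.a u (A u) := by
  obtain ⟨C, hC0, hC⟩ := H2.exists_ae_bound hΩ θ.1
  have hint := integrable_diffusion (a := θ.a) hC
  obtain ⟨B, hB⟩ := exists_clm_of_integral
    (fun (u w : H10 Ω) x => θ.a x * inner ℝ (grad u x) (grad w x)) (C := C)
    (fun u w => hint (grad u) (grad w))
    (fun u v w => by
      filter_upwards [grad_add_ae u v] with x hx
      rw [hx, inner_add_left, mul_add])
    (fun r u w => by
      filter_upwards [grad_smul_ae r u] with x hx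
      rw [hx, real_inner_smul_left]; ring)
    (fun u w => Eventually.of_forall fun x => by simp only [real_inner_comm])
    (fun u w => by
      have hn : Integrable (fun x => ‖grad u x‖ * ‖grad w x‖) (volume.restrict Ω) :=
        (Lp.memLp (grad u)).norm.integrable_mul (Lp.memLp (grad w)).norm
      have h1 : |∫ x in Ω, θ.a x * inner ℝ (grad u x) (grad w x)| ≤
          ∫ x in Ω, C * (‖grad u x‖ * ‖grad w x‖) := by
        rw [← Real.norm_eq_abs]
        refine norm_integral_le_of_norm_le (hn.const_mul C) ?_
        filter_upwards [hC] with x hx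
        rw [norm_mul]
        exact mul_le_mul hx (norm_inner_le_norm _ _) (norm_nonneg _) hC0
      have h2 : ∫ x in Ω, ‖grad u x‖ * ‖grad w x‖ ≤ ‖grad u‖ * ‖grad w‖ := by
        have := integral_mul_norm_le_Lp_mul_Lq (μ := volume.restrict Ω)
          (f := fun x => grad u x) (g := fun x => grad w x) Real.HolderConjugate.two_two
          (by simpa using Lp.memLp (grad u)) (by simpa using Lp.memLp (grad w))
        refine this.trans (le_of_eq ?_)
        have hn2 : ∀ g : L2vec Ω, (∫ x in Ω, ‖g x‖ ^ (2 : ℝ)) ^ (1 / 2 : ℝ) = ‖g‖ := by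
          intro g
          rw [← Real.sqrt_eq_rpow, eq_comm, ← Real.sqrt_sq (norm_nonneg g),
            ← real_inner_self_eq_norm_sq, L2.inner_def]
          simp
        rw [hn2, hn2]
      rw [integral_const_mul] at h1
      refine h1.trans ?_
      rw [mul_assoc]
      refine mul_le_mul_of_nonneg_left (h2.trans ?_) hC0
      exact mul_le_mul (norm_grad_le u) (norm_grad_le w) (norm_nonneg _) (norm_nonneg _))
  exact ⟨B, fun u w => ⟨hint (grad u) (grad w), hB u w⟩⟩

lemma eLpNorm_mul_mul_le (c f g : E3 → ℝ) {μ : Measure E3} (hc : AEStronglyMeasurable c μ)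
    (hf : AEStronglyMeasurable f μ) (hg : AEStronglyMeasurable g μ) :
    eLpNorm (fun x => c x * f x * g x) 1 μ ≤ eLpNorm c 2 μ * (eLpNorm f 4 μ * eLpNorm g 4 μ) := by
  have : ENNReal.HolderTriple 4 4 2 := ⟨by
    rw [← ENNReal.toReal_eq_toReal_iff' (by simp) (by simp), ENNReal.toReal_add (by simp) (by simp)]
    simp; norm_num⟩
  have h1 := eLpNorm_smul_le_mul_eLpNorm (r := 1) (p := 2) (q := 2) (hf.mul hg) hc
  have h2 := eLpNorm_smul_le_mul_eLpNorm (r := 2) (p := 4) (q := 4) hg hf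
  have e : (fun x => c x * f x * g x) = c • (f * g) := by
    funext x; simp [mul_assoc]
  rw [e]
  exact h1.trans (by gcongr; exact h2)

/-- The potential operator, with the bounds that follow from the embedding `U ⊆ L⁴`. -/
lemma exists_potential (hΩ : IsOpen Ω) : ∃ K : ℝ, 0 ≤ K ∧ ∀ c : L2 Ω,
    ∃ B : H10 Ω →L[ℝ] Hm1 Ω, (∀ u, IsPotential c u (B u)) ∧
      ∀ u, (B u u) ^ 2 ≤ ‖c‖ ^ 2 * (K * ‖toH u‖ * ‖grad u‖ ^ 3) := by
  obtain ⟨K, hK0, hK⟩ := exists_eLpNorm_four_le hΩ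
  refine ⟨K, hK0, fun c => ?_⟩
  set N : H10 Ω → ℝ := fun u => (K * ‖toH u‖ * ‖grad u‖ ^ 3) ^ (1 / 4 : ℝ) with hNdef
  have hN0 : ∀ u, 0 ≤ N u := fun u => by positivity
  have hN4 : ∀ u, N u ^ 4 = K * ‖toH u‖ * ‖grad u‖ ^ 3 := fun u => by
    rw [hNdef]
    simp only
    rw [← Real.rpow_natCast, ← Real.rpow_mul (by positivity)]
    norm_num
  have hle : ∀ u w : H10 Ω, eLpNorm (fun x => c x * toH u x * toH w x) 1 (volume.restrict Ω) ≤
      ENNReal.ofReal (‖c‖ * (N u * N w)) := fun u w => by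
    refine (eLpNorm_mul_mul_le _ _ _ (Lp.aestronglyMeasurable c) (Lp.aestronglyMeasurable _)
      (Lp.aestronglyMeasurable _)).trans ?_
    rw [ENNReal.ofReal_mul (norm_nonneg c), ENNReal.ofReal_mul (hN0 u), ofReal_norm, Lp.enorm_def]
    gcongr
    · exact hK u
    · exact hK w
  have hint : ∀ u w : H10 Ω, Integrable (fun x => c x * toH u x * toH w x) (volume.restrict Ω) :=
    fun u w => memLp_one_iff_integrable.1
      ⟨((Lp.aestronglyMeasurable c).mul (Lp.aestronglyMeasurable _)).mul
        (Lp.aestronglyMeasurable _), (hle u w).trans_lt ENNReal.ofReal_lt_top⟩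
  have hbd : ∀ u w : H10 Ω, |∫ x in Ω, c x * toH u x * toH w x| ≤ ‖c‖ * (N u * N w) := by
    intro u w
    have h1 := (enorm_integral_le_lintegral_enorm (μ := volume.restrict Ω)
      (fun x => c x * toH u x * toH w x))
    rw [← eLpNorm_one_eq_lintegral_enorm] at h1
    have h2 := h1.trans (hle u w)
    rw [← ofReal_norm, ENNReal.ofReal_le_ofReal_iff
      (mul_nonneg (norm_nonneg c) (mul_nonneg (hN0 u) (hN0 w)))] at h2
    exact h2
  -- The inequality `K ≤ (K + 1) ^ 4` avoids a fourth root of `K`.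
  have hNU : ∀ u, N u ≤ (K + 1) * ‖u‖ := fun u => by
    refine le_of_pow_le_pow_left₀ four_ne_zero (by positivity) ?_
    rw [hN4, mul_pow]
    calc K * ‖toH u‖ * ‖grad u‖ ^ 3 ≤ K * ‖u‖ * ‖u‖ ^ 3 := by
          gcongr
          · exact norm_toH_le u
          · exact norm_grad_le u
      _ = K * ‖u‖ ^ 4 := by ring
      _ ≤ (K + 1) ^ 4 * ‖u‖ ^ 4 := by
          gcongr
          calc K ≤ K + 1 := by linarith
            _ ≤ (K + 1) ^ 4 := le_self_pow₀ (by linarith) four_ne_zero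
  obtain ⟨B, hB⟩ := exists_clm_of_integral
    (fun (u w : H10 Ω) x => c x * toH u x * toH w x) (C := ‖c‖ * (K + 1) ^ 2) hint
    (fun u v w => by
      filter_upwards [toH_add_ae u v] with x hx
      rw [hx]; ring)
    (fun r u w => by
      filter_upwards [toH_smul_ae r u] with x hx
      rw [hx]; ring)
    (fun u w => Eventually.of_forall fun x => by simp only; ring)
    (fun u w => by
      refine (hbd u w).trans ?_
      calc ‖c‖ * (N u * N w) ≤ ‖c‖ * (((K + 1) * ‖u‖) * ((K + 1) * ‖w‖)) := by
            gcongr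
            · exact hNU u
            · exact hNU w
        _ = _ := by ring)
  refine ⟨B, fun u w => ⟨hint u w, hB u w⟩, fun u => ?_⟩
  have h1 := hbd u u
  rw [← hB u u] at h1
  calc (B u u) ^ 2 = |B u u| ^ 2 := (sq_abs _).symm
    _ ≤ (‖c‖ * (N u * N u)) ^ 2 := by gcongr
    _ = ‖c‖ ^ 2 * N u ^ 4 := by ring
    _ = _ := by rw [hN4]

end Operators

/-! ### Gronwall's inequality and the integrated energy estimate -/

section Gronwall

lemma integral_gronwall {g : ℝ → ℝ} {τ Q κ : ℝ} (hτ : 0 < τ) (hκ : 0 ≤ κ)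
    (hg : ContinuousOn g (Icc 0 τ))
    (h : ∀ t ∈ Icc 0 τ, g t ≤ Q + κ * ∫ r in (0 : ℝ)..t, g r) :
    Q + κ * ∫ r in (0 : ℝ)..τ, g r ≤ Q * Real.exp (κ * τ) := by
  have hgi : IntervalIntegrable g volume 0 τ := by
    refine ContinuousOn.intervalIntegrable ?_
    rwa [uIcc_of_le hτ.le]
  -- The hypothesis says exactly that the derivative of this product is nonpositive.
  set z : ℝ → ℝ := fun t => (Q + κ * ∫ r in (0 : ℝ)..t, g r) * Real.exp (-(κ * t)) with hz
  have hyc : ContinuousOn (fun t => ∫ r in (0 : ℝ)..t, g r) (Icc 0 τ) := by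
    have := (absolutelyContinuousOnInterval_integral hgi).continuousOn
    rwa [uIcc_of_le hτ.le] at this
  have hzc : ContinuousOn z (Icc 0 τ) :=
    (continuousOn_const.add (continuousOn_const.mul hyc)).mul (by fun_prop)
  have hd : ∀ t ∈ Ioo 0 τ, HasDerivAt z
      (κ * g t * Real.exp (-(κ * t)) +
        (Q + κ * ∫ r in (0 : ℝ)..t, g r) * (Real.exp (-(κ * t)) * -κ)) t := by
    intro t ht
    have hnhds : Icc 0 τ ∈ 𝓝 t := Icc_mem_nhds ht.1 ht.2
    have h1 : HasDerivAt (fun t => ∫ r in (0 : ℝ)..t, g r) (g t) t :=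
      intervalIntegral.integral_hasDerivAt_right
        (hgi.mono_set (by
          rw [uIcc_of_le ht.1.le, uIcc_of_le hτ.le]; exact Icc_subset_Icc_right ht.2.le))
        (hg.stronglyMeasurableAtFilter_nhdsWithin measurableSet_Icc t |>.filter_mono
          (by rw [nhdsWithin_eq_nhds.2 hnhds])) (hg.continuousAt hnhds)
    have h2 : HasDerivAt (fun t => Real.exp (-(κ * t))) (Real.exp (-(κ * t)) * -κ) t := by
      have h3 : HasDerivAt (fun t : ℝ => -(κ * t)) (-κ) t := by
        simpa using ((hasDerivAt_id t).const_mul κ).fun_neg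
      exact h3.exp
    exact ((h1.const_mul κ).const_add Q).fun_mul h2
  have hanti : AntitoneOn z (Icc 0 τ) := by
    refine antitoneOn_of_deriv_nonpos (convex_Icc 0 τ) hzc ?_ ?_
    · rw [interior_Icc]
      exact fun t ht => (hd t ht).differentiableAt.differentiableWithinAt
    · rw [interior_Icc]
      intro t ht
      rw [(hd t ht).deriv]
      have := h t ⟨ht.1.le, ht.2.le⟩
      have h4 : 0 ≤ κ * Real.exp (-(κ * t)) := by positivity
      nlinarith
  have hfin := hanti (left_mem_Icc.2 hτ.le) (right_mem_Icc.2 hτ.le) hτ.le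
  simp only [hz, intervalIntegral.integral_same, mul_zero, add_zero, neg_zero, Real.exp_zero,
    mul_one] at hfin
  rw [Real.exp_neg, ← div_eq_mul_inv, div_le_iff₀ (Real.exp_pos _)] at hfin
  exact hfin

lemma integral_le_of_energy {g e n s : ℝ → ℝ} {τ α β κ : ℝ} (hτ : 0 < τ) (hα : 0 ≤ α) (hβ : 0 ≤ β)
    (hκ : 0 ≤ κ) (hg : ContinuousOn g (Icc 0 τ)) (hg0 : ∀ t, 0 ≤ g t) (hn0 : ∀ t, 0 ≤ n t)
    (hs0 : ∀ t, 0 ≤ s t) (he : IntegrableOn e (Ioo 0 τ)) (hn : IntegrableOn n (Ioo 0 τ))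
    (hs : IntegrableOn s (Ioo 0 τ))
    (hid : ∀ t ∈ Icc 0 τ, g t - g 0 = ∫ r in (0 : ℝ)..t, e r)
    (hle : ∀ᵐ t ∂(volume.restrict (Ioo 0 τ)), e t ≤ -α * n t + β * s t + κ * g t) :
    α * ∫ t in Ioo 0 τ, n t ≤ (g 0 + β * ∫ t in Ioo 0 τ, s t) * Real.exp (κ * τ) := by
  have hμ : volume.restrict (Ioo 0 τ) = volume.restrict (Ioc 0 τ) :=
    Measure.restrict_congr_set Ioo_ae_eq_Ioc
  simp only [IntegrableOn, hμ] at *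
  have hgi : IntegrableOn g (Ioc 0 τ) := hg.integrableOn_Icc.mono_set Ioc_subset_Icc_self
  -- The dissipation stays on the left. It is dropped to apply Gronwall to `g`, then recovered at `t
  -- = τ` by dropping `g τ ≥ 0` instead.
  have key : ∀ t ∈ Icc 0 τ, g t + α * ∫ r in Ioc 0 t, n r ≤
      (g 0 + β * ∫ r in Ioc 0 τ, s r) + κ * ∫ r in (0 : ℝ)..t, g r := by
    intro t ht
    have hsub : Ioc 0 t ⊆ Ioc 0 τ := Ioc_subset_Ioc_right ht.2
    have hm : volume.restrict (Ioc 0 t) ≤ volume.restrict (Ioc 0 τ) :=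
      Measure.restrict_mono hsub le_rfl
    have i1 := (hn.mono_measure hm).const_mul (-α)
    have i2 := (hs.mono_measure hm).const_mul β
    have i3 := (Integrable.mono_measure hgi hm).const_mul κ
    have h1 : ∫ r in Ioc 0 t, e r ≤ ∫ r in Ioc 0 t, (-α * n r + β * s r + κ * g r) :=
      integral_mono_ae (he.mono_measure hm) ((i1.add i2).add i3) (ae_mono hm hle)
    rw [integral_add (i1.fun_add i2) i3, integral_add i1 i2, integral_const_mul, integral_const_mul,
      integral_const_mul] at h1
    have h2 : ∫ r in Ioc 0 t, s r ≤ ∫ r in Ioc 0 τ, s r :=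
      setIntegral_mono_set hs (Eventually.of_forall hs0) (LE.le.eventuallyLE hsub)
    have h3 := hid t ht
    rw [intervalIntegral.integral_of_le ht.1] at h3 ⊢
    nlinarith [mul_le_mul_of_nonneg_left h2 hβ]
  have hgr := integral_gronwall hτ hκ hg (Q := g 0 + β * ∫ r in Ioc 0 τ, s r) fun t ht => by
    have h1 := key t ht
    have h2 : 0 ≤ α * ∫ r in Ioc 0 t, n r := mul_nonneg hα (integral_nonneg hn0)
    linarith
  have := key τ (right_mem_Icc.2 hτ.le)
  linarith [hg0 τ]

end Gronwall

/-! ### Calculus in `𝒱` -/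

section TimeDerivative

variable {Ω : Set E3} {T : ℝ}

lemma Lp_norm_sq_eq_integral {α E : Type*} [MeasurableSpace α] {μ : Measure α}
    [NormedAddCommGroup E] (f : Lp E 2 μ) : ‖f‖ ^ 2 = ∫ x, ‖f x‖ ^ 2 ∂μ := by
  rw [Lp.norm_def, (Lp.memLp f).eLpNorm_eq_integral_rpow_norm (by norm_num) (by norm_num),
    ENNReal.toReal_ofReal (by positivity), ← Real.rpow_natCast,
    ← Real.rpow_mul (integral_nonneg fun x => by positivity)]
  simp

lemma integrable_norm_sq {α E : Type*} [MeasurableSpace α] {μ : Measure α}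
    [NormedAddCommGroup E] (f : Lp E 2 μ) : Integrable (fun x => ‖f x‖ ^ 2) μ :=
  (Lp.memLp f).integrable_norm_pow two_ne_zero

/-- The second function is the weak time derivative of the first one, with respect to the embedding
`U → U*` induced by `A`. -/
def HasWeakTimeDerivative {U H : Type*} [NormedAddCommGroup U] [InnerProductSpace ℝ U]
    [NormedAddCommGroup H] [InnerProductSpace ℝ H] (A : U →L[ℝ] H)
    (u : Lp U 2 (timeMeasure T)) (u' : Lp (U →L[ℝ] ℝ) 2 (timeMeasure T)) : Prop :=
  ∀ ψ : ℝ → ℝ, IsTestFunction (Ioo 0 T) ψ →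
    ∫ t in Ioo 0 T, deriv ψ t • pullbackInner A (u t) = - ∫ t in Ioo 0 T, ψ t • u' t

section Abstract

variable {U H : Type*} [NormedAddCommGroup U] [InnerProductSpace ℝ U]
  [NormedAddCommGroup H] [InnerProductSpace ℝ H] {A : U →L[ℝ] H}
  {u v : Lp U 2 (timeMeasure T)} {u' v' : Lp (U →L[ℝ] ℝ) 2 (timeMeasure T)}

lemma integrable_of_Lp_two {E : Type*} [NormedAddCommGroup E] (f : Lp E 2 (timeMeasure T)) :
    Integrable f (timeMeasure T) :=
  (Lp.memLp f).integrable (by norm_num)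

lemma integrable_pullbackInner (A : U →L[ℝ] H) (u : Lp U 2 (timeMeasure T)) :
    Integrable (fun t => pullbackInner A (u t)) (timeMeasure T) :=
  (pullbackInner A).integrable_comp (integrable_of_Lp_two u)

lemma HasWeakTimeDerivative.sub (hu : HasWeakTimeDerivative A u u')
    (hv : HasWeakTimeDerivative A v v') : HasWeakTimeDerivative A (u - v) (u' - v') := by
  intro ψ hψ
  have hc : Continuous (deriv ψ) := hψ.1.continuous_deriv (by simp)
  have e1 : ∫ t in Ioo 0 T, deriv ψ t • pullbackInner A ((u - v) t) =
      ∫ t in Ioo 0 T, (deriv ψ t • pullbackInner A (u t) - deriv ψ t • pullbackInner A (v t)) := by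
    refine integral_congr_ae ?_
    filter_upwards [Lp.coeFn_sub u v] with t ht
    rw [ht, Pi.sub_apply, map_sub, smul_sub]
  have e2 : ∫ t in Ioo 0 T, ψ t • (u' - v') t =
      ∫ t in Ioo 0 T, (ψ t • u' t - ψ t • v' t) := by
    refine integral_congr_ae ?_
    filter_upwards [Lp.coeFn_sub u' v'] with t ht
    rw [ht, Pi.sub_apply, smul_sub]
  rw [e1, e2, integral_sub
      (integrable_smul_of_continuous_compact (integrable_pullbackInner A u) hc hψ.2.1.deriv)
      (integrable_smul_of_continuous_compact (integrable_pullbackInner A v) hc hψ.2.1.deriv),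
    integral_sub
      (integrable_smul_of_continuous_compact (integrable_of_Lp_two u') hψ.1.continuous hψ.2.1)
      (integrable_smul_of_continuous_compact (integrable_of_Lp_two v') hψ.1.continuous hψ.2.1),
    hu ψ hψ, hv ψ hψ]
  abel

lemma HasWeakTimeDerivative.unique (hu : HasWeakTimeDerivative A u u')
    (hv : HasWeakTimeDerivative A u v') : u' = v' := by
  have hd := hu.sub hv
  rw [sub_self] at hd
  have hz := isOpen_Ioo.ae_eq_zero_of_integral_contDiff_smul_eq_zero (μ := volume)
    (f := (u' - v' : Lp (U →L[ℝ] ℝ) 2 (timeMeasure T))) (U := Ioo 0 T)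
    (IntegrableOn.locallyIntegrableOn (integrable_of_Lp_two (u' - v'))) fun ψ h1 h2 h3 => by
      have hψ : IsTestFunction (Ioo 0 T) ψ := ⟨h1, h2, h3⟩
      have h := hd ψ hψ
      have h0 : ∫ t in Ioo 0 T,
          deriv ψ t • pullbackInner A ((0 : Lp U 2 (timeMeasure T)) t) = 0 := by
        refine integral_eq_zero_of_ae ?_
        filter_upwards [Lp.coeFn_zero U 2 (timeMeasure T)] with t ht
        rw [ht, Pi.zero_apply, map_zero, smul_zero, Pi.zero_apply]
      rw [h0] at h
      rw [← setIntegral_eq_integral_of_forall_compl_eq_zero (s := Ioo 0 T) fun t ht => by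
        rw [hψ.eq_zero_of_notMem ht, zero_smul]]
      exact neg_eq_zero.1 h.symm
  rw [← sub_eq_zero, Lp.eq_zero_iff_ae_eq_zero]
  exact (ae_restrict_iff' measurableSet_Ioo).2 hz

lemma HasWeakTimeDerivative.exists_representative [CompleteSpace U] [CompleteSpace H]
    (hA : Function.Injective A) (hT : 0 < T) (hu : HasWeakTimeDerivative A u u') :
    ∃ w : ℝ → H, ContinuousOn w (Icc 0 T) ∧ (∀ᵐ t ∂(timeMeasure T), w t = A (u t)) ∧
      ∀ t ∈ Icc 0 T, ‖w t‖ ^ 2 - ‖w 0‖ ^ 2 = ∫ r in (0 : ℝ)..t, 2 * u' r (u r) := by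
  obtain ⟨ξ, hξ⟩ := exists_ae_eq_primitive hT (integrable_pullbackInner A u)
    (integrable_of_Lp_two u') hu
  exact exists_continuous_representative A hA hT (Lp.memLp u) (Lp.memLp u') hξ

lemma integrable_dual_pairing (u : Lp U 2 (timeMeasure T))
    (u' : Lp (U →L[ℝ] ℝ) 2 (timeMeasure T)) :
    Integrable (fun t => 2 * u' t (u t)) (timeMeasure T) := by
  refine Integrable.const_mul ?_ 2
  refine ((Lp.memLp u').norm.integrable_mul (Lp.memLp u).norm).mono' ?_
    (Eventually.of_forall fun t => (u' t).le_opNorm (u t))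
  exact (isBoundedBilinearMap_apply (𝕜 := ℝ) (E := U)
    (F := ℝ)).continuous.comp_aestronglyMeasurable
      ((Lp.aestronglyMeasurable u').prodMk (Lp.aestronglyMeasurable u))

lemma exists_Lp_sum (u : Lp U 2 (timeMeasure T)) (u' : Lp (U →L[ℝ] ℝ) 2 (timeMeasure T))
    (P Q : U →L[ℝ] U →L[ℝ] ℝ) {Φ : U → U →L[ℝ] ℝ} (hΦ : MemLp (fun t => Φ (u t)) 2 (timeMeasure T))
    (φ : U →L[ℝ] ℝ) : ∃ y : Lp (U →L[ℝ] ℝ) 2 (timeMeasure T), ∀ᵐ t ∂(timeMeasure T),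
      y t = u' t + P (u t) + Q (u t) + Φ (u t) - φ := by
  have hmem : MemLp (fun t => u' t + P (u t) + Q (u t) + Φ (u t) - φ) 2 (timeMeasure T) :=
    ((((Lp.memLp u').add (P.comp_memLp u)).add (Q.comp_memLp u)).add hΦ).sub (memLp_const φ)
  exact ⟨hmem.toLp _, hmem.coeFn_toLp⟩

end Abstract

/-- Definitional, because `gelfand u` unfolds to `pullbackInner (toHL Ω) u`. -/
lemma isTimeDerivative_iff {u : StateSpace Ω T} {u' : DualStateSpace Ω T} :
    IsTimeDerivative u u' ↔ HasWeakTimeDerivative (toHL Ω) u u' := Iff.rfl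

lemma IsTimeDerivative.sub {u v : StateSpace Ω T} {u' v' : DualStateSpace Ω T}
    (hu : IsTimeDerivative u u') (hv : IsTimeDerivative v v') :
    IsTimeDerivative (u - v) (u' - v') :=
  isTimeDerivative_iff.2 ((isTimeDerivative_iff.1 hu).sub (isTimeDerivative_iff.1 hv))

lemma IsTimeDerivative.unique {u : StateSpace Ω T} {u' v' : DualStateSpace Ω T}
    (hu : IsTimeDerivative u u') (hv : IsTimeDerivative u v') : u' = v' :=
  (isTimeDerivative_iff.1 hu).unique (isTimeDerivative_iff.1 hv)

/-- The continuous representative and the energy identity for an element of `𝒱`. -/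
lemma IsTimeDerivative.exists_representative (hΩ : IsOpen Ω) (hT : 0 < T) {u : StateSpace Ω T}
    {u' : DualStateSpace Ω T} (hu : IsTimeDerivative u u') :
    ∃ w : ℝ → L2 Ω, ContinuousOn w (Icc 0 T) ∧ (∀ᵐ t ∂(timeMeasure T), w t = toH (u t)) ∧
      ∀ t ∈ Icc 0 T, ‖w t‖ ^ 2 - ‖w 0‖ ^ 2 = ∫ r in (0 : ℝ)..t, 2 * u' r (u r) :=
  (isTimeDerivative_iff.1 hu).exists_representative (toHL_injective hΩ) hT

/-- Continuous functions that agree almost everywhere on `(0, T)` agree on it, hence on its closure,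
which contains `0`. -/
lemma HasInitialValue.unique (hT : 0 < T) {u : StateSpace Ω T} {h k : L2 Ω}
    (hh : HasInitialValue u h) (hk : HasInitialValue u k) : h = k := by
  obtain ⟨w, hwc, hw, rfl⟩ := hh
  obtain ⟨z, hzc, hz, rfl⟩ := hk
  have hae : w =ᵐ[volume.restrict (Ioo 0 T)] z := by
    filter_upwards [hw, hz] with t h1 h2
    rw [h1, h2]
  have heq : EqOn w z (Ioo 0 T) :=
    Measure.eqOn_open_of_ae_eq hae isOpen_Ioo (hwc.mono Ioo_subset_Icc_self)
      (hzc.mono Ioo_subset_Icc_self)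
  have hcl : closure (Ioo 0 T) = Icc 0 T := closure_Ioo hT.ne
  exact heq.of_subset_closure hwc hzc Ioo_subset_Icc_self hcl.ge (left_mem_Icc.2 hT.le)

lemma HasInitialValue.sub {u v : StateSpace Ω T} {h k : L2 Ω}
    (hh : HasInitialValue u h) (hk : HasInitialValue v k) : HasInitialValue (u - v) (h - k) := by
  obtain ⟨w, hwc, hw, rfl⟩ := hh
  obtain ⟨z, hzc, hz, rfl⟩ := hk
  refine ⟨fun t => w t - z t, hwc.sub hzc, ?_, rfl⟩
  filter_upwards [hw, hz, Lp.coeFn_sub u v] with t h1 h2 h3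
  rw [h1, h2, h3]
  exact (map_sub (toHL Ω) (u t) (v t)).symm

end TimeDerivative

/-! ### Well-definedness of `F_θ` and lower bounds -/

section Model

variable {Ω : Set E3} {T : ℝ}

lemma IsDiffusion.unique {a : L2 Ω} {u : H10 Ω} {ξ η : Hm1 Ω} (h1 : IsDiffusion a u ξ)
    (h2 : IsDiffusion a u η) : ξ = η :=
  ContinuousLinearMap.ext fun w => (h1 w).2.trans (h2 w).2.symm

lemma IsPotential.unique {c : L2 Ω} {u : H10 Ω} {ξ η : Hm1 Ω} (h1 : IsPotential c u ξ)
    (h2 : IsPotential c u η) : ξ = η :=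
  ContinuousLinearMap.ext fun w => (h1 w).2.trans (h2 w).2.symm

lemma IsPDEValue.unique (hT : 0 < T) {Φ : H10 Ω → Hm1 Ω} {θ : Param Ω} {u : StateSpace Ω T}
    {y z : DualStateSpace Ω T × L2 Ω} (hy : IsPDEValue Φ θ u y) (hz : IsPDEValue Φ θ u z) :
    y = z := by
  obtain ⟨⟨u', hu', hy1⟩, h, hh, hy2⟩ := hy
  obtain ⟨⟨v', hv', hz1⟩, k, hk, hz2⟩ := hz
  obtain rfl := hu'.unique hv'
  obtain rfl := hh.unique hT hk
  refine Prod.ext (Lp.ext ?_) (hy2.trans hz2.symm)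
  filter_upwards [hy1, hz1] with t h1 h2
  obtain ⟨d, p, hd, hp, e1⟩ := h1
  obtain ⟨d', p', hd', hp', e2⟩ := h2
  rw [e1, e2, hd.unique hd', hp.unique hp']

lemma exists_isPDEValue (hΩ : IsBoundedLipschitzDomain Ω) (hT : 0 < T) {Φ : H10 Ω → Hm1 Ω}
    (hNem : InducesNemytskii T Φ) (θ : Param Ω) {u : StateSpace Ω T} (hu : u ∈ smoothStates Ω T) :
    ∃ y, IsPDEValue Φ θ u y := by
  obtain ⟨u', hu'⟩ := id hu
  obtain ⟨A, hA⟩ := exists_diffusion hΩ θ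
  obtain ⟨K, -, hP⟩ := exists_potential hΩ.isOpen
  obtain ⟨B, hB, -⟩ := hP θ.c
  obtain ⟨w, hwc, hw, -⟩ := hu'.exists_representative hΩ.isOpen hT
  obtain ⟨y, hy⟩ := exists_Lp_sum u u' A B (hNem u hu) θ.φ
  refine ⟨(y, θ.u₀ - w 0), ⟨u', hu', ?_⟩, w 0, ⟨w, hwc, hw, rfl⟩, rfl⟩
  filter_upwards [hy] with t ht
  exact ⟨A (u t), B (u t), hA _, hB _, ht⟩

/-- As `pdeMap` is a choice with default `0`, this equivalence carries both existence and uniqueness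
of the value: on `𝒱` the default branch is never taken. -/
lemma isPDEValue_iff (hΩ : IsBoundedLipschitzDomain Ω) (hT : 0 < T) {Φ : H10 Ω → Hm1 Ω}
    (hNem : InducesNemytskii T Φ) (θ : Param Ω) {u : StateSpace Ω T} (hu : u ∈ smoothStates Ω T)
    (y : DualStateSpace Ω T × L2 Ω) : IsPDEValue Φ θ u y ↔ y = pdeMap Φ θ u := by
  have hex := exists_isPDEValue hΩ hT hNem θ hu
  have hch : IsPDEValue Φ θ u (pdeMap Φ θ u) := by
    rw [pdeMap, dif_pos hex]
    exact hex.choose_spec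
  exact ⟨fun hy => hy.unique hT hch, fun hy => hy ▸ hch⟩

/-- Young's inequality without fractional powers: `A h g³` is the product of `δ g²` and `(A/δ) g h`,
and both factors are at most the right side, the second by completing the square. -/
lemma le_add_of_sq_le_mul {s A h g δ : ℝ} (hδ : 0 < δ) (hA : 0 ≤ A) (hh : 0 ≤ h) (hg : 0 ≤ g)
    (hs : s ^ 2 ≤ A * (h * g ^ 3)) : |s| ≤ δ * g ^ 2 + A ^ 2 / δ ^ 3 * h ^ 2 := by
  set X := δ * g ^ 2 + A ^ 2 / δ ^ 3 * h ^ 2 with hX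
  have hX0 : 0 ≤ X := by positivity
  have h1 : δ * g ^ 2 ≤ X := le_add_of_nonneg_right (by positivity)
  have h2 : A / δ * (g * h) ≤ X := by
    have e : X - 2 * (A / δ * (g * h)) = δ * (g - A / δ ^ 2 * h) ^ 2 := by
      rw [hX]; field_simp; ring
    have : 0 ≤ δ * (g - A / δ ^ 2 * h) ^ 2 := by positivity
    have h3 : 0 ≤ A / δ * (g * h) := by positivity
    linarith
  refine abs_le_of_sq_le_sq (hs.trans ?_) hX0
  calc A * (h * g ^ 3) = δ * g ^ 2 * (A / δ * (g * h)) := by field_simp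
    _ ≤ X * X := mul_le_mul h1 h2 (by positivity) hX0
    _ = X ^ 2 := by ring

/-- Both structural assumptions on `Φ` give a lower bound of Gårding type. -/
lemma exists_lower_bound {Φ : H10 Ω → Hm1 Ω}
    (hΦ : IsLipschitzNonlinearity Φ ∨ IsMonotoneType Φ) {ε : ℝ} (hε : 0 < ε) :
    ∃ M : ℝ, 0 ≤ M ∧ ∀ u v : H10 Ω,
      -(ε * ‖u - v‖ ^ 2) - M * ‖toH (u - v)‖ ^ 2 ≤ (Φ u - Φ v) (u - v) := by
  rcases hΦ with ⟨L, hL, h⟩ | ⟨M, hM, h⟩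
  -- Young's inequality for `L k n`; the optimal constant would be `L² / (4ε)`.
  · refine ⟨L ^ 2 / ε, by positivity, fun u v => ?_⟩
    have h1 := (neg_abs_le _).trans' (neg_le_neg (((Φ u - Φ v).le_opNorm (u - v)).trans
      (mul_le_mul_of_nonneg_right (h u v) (norm_nonneg _))))
    refine le_trans ?_ h1
    set n := ‖u - v‖
    set k := ‖toH (u - v)‖
    have e : ε * n ^ 2 + L ^ 2 / ε * k ^ 2 - L * k * n =
        ε * (n - L / (2 * ε) * k) ^ 2 + 3 / 4 * (L ^ 2 / ε * k ^ 2) := by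
      field_simp; ring
    have : 0 ≤ ε * (n - L / (2 * ε) * k) ^ 2 + 3 / 4 * (L ^ 2 / ε * k ^ 2) := by positivity
    linarith
  · refine ⟨M, hM, fun u v => ?_⟩
    have h1 := h u v
    have h2 : 0 ≤ ε * ‖u - v‖ ^ 2 := by positivity
    linarith

lemma IsDiffusion.lower_bound {a : L2 Ω} {amin : ℝ}
    (ha : ∀ᵐ x ∂(volume.restrict Ω), amin ≤ a x) {u : H10 Ω} {ξ : Hm1 Ω} (h : IsDiffusion a u ξ) :
    amin * ‖grad u‖ ^ 2 ≤ ξ u := by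
  rw [(h u).2, Lp_norm_sq_eq_integral, ← integral_const_mul]
  refine integral_mono_ae ((integrable_norm_sq (grad u)).const_mul amin) (h u).1 ?_
  filter_upwards [ha] with x hx
  rw [real_inner_self_eq_norm_sq]
  exact mul_le_mul_of_nonneg_right hx (by positivity)

lemma norm_c_le {θ θd : Param Ω} {R : ℝ} (h : θ ∈ Metric.closedBall θd R) :
    ‖θ.c‖ ≤ ‖θd.c‖ + R := by
  have h1 : dist θ.c θd.c ≤ R :=
    ((le_max_left (dist θ.2.1 θd.2.1) (dist θ.2.2 θd.2.2)).trans
      (le_max_right (dist θ.1 θd.1) (dist θ.2 θd.2))).trans h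
  rw [dist_eq_norm] at h1
  linarith [norm_le_norm_add_norm_sub' θ.c θd.c]

end Model

/-! ### The energy estimate for differences -/

section Coercivity

variable {Ω : Set E3} {T : ℝ}

lemma sub_eq_of_eq_add_sub {G : Type*} [AddCommGroup G] {w u v x y z d d' e p p' q f f' φ : G}
    (hw : w = u - v) (hx : x = y - z) (hy : y = u + d + p + f - φ) (hz : z = v + d' + p' + f' - φ)
    (he : e = d - d') (hq : q = p - p') : w = x - e - q - (f - f') := by
  rw [hw, hx, hy, hz, he, hq]; abel

set_option maxHeartbeats 1000000 in
lemma IsPDEValue.exists_sub {Φ : H10 Ω → Hm1 Ω} {θ : Param Ω} {A B : H10 Ω →L[ℝ] Hm1 Ω}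
    (hA : ∀ u, IsDiffusion θ.a u (A u)) (hB : ∀ u, IsPotential θ.c u (B u))
    {u v : StateSpace Ω T} {y z : DualStateSpace Ω T × L2 Ω} (hy : IsPDEValue Φ θ u y)
    (hz : IsPDEValue Φ θ v z) :
    ∃ w' : DualStateSpace Ω T, IsTimeDerivative (u - v) w' ∧
      (∀ᵐ t ∂(timeMeasure T), (u - v) t = u t - v t ∧
        w' t = (y.1 - z.1) t - A (u t - v t) - B (u t - v t) - (Φ (u t) - Φ (v t))) ∧
      HasInitialValue (u - v) (z.2 - y.2) := by
  obtain ⟨⟨u', hu', hy1⟩, h, hh, hy2⟩ := hy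
  obtain ⟨⟨v', hv', hz1⟩, k, hk, hz2⟩ := hz
  refine ⟨u' - v', hu'.sub hv', ?_, ?_⟩
  · filter_upwards [hy1, hz1, Lp.coeFn_sub u v, Lp.coeFn_sub u' v', Lp.coeFn_sub y.1 z.1]
      with t h1 h2 e1 e2 e3
    obtain ⟨d, p, hd, hp, ey⟩ := h1
    obtain ⟨d', p', hd', hp', ez⟩ := h2
    obtain rfl := hd.unique (hA _)
    obtain rfl := hd'.unique (hA _)
    obtain rfl := hp.unique (hB _)
    obtain rfl := hp'.unique (hB _)
    exact ⟨e1, sub_eq_of_eq_add_sub e2 e3 ey ez (A.map_sub _ _) (B.map_sub _ _)⟩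
  · have := hh.sub hk
    rwa [show h - k = z.2 - y.2 by rw [hy2, hz2]; abel] at this

/-- The pointwise differential inequality behind the energy estimate. -/
lemma dual_pairing_le {Φ : H10 Ω → Hm1 Ω} {A B : H10 Ω →L[ℝ] Hm1 Ω} {α M S : ℝ} (hα : 0 < α)
    (hS : 0 ≤ S) (hA : ∀ w, α * ‖grad w‖ ^ 2 ≤ A w w)
    (hB : ∀ w, (B w w) ^ 2 ≤ S * (‖toH w‖ * ‖grad w‖ ^ 3))
    (hΦ : ∀ u v : H10 Ω,
      -(α / 4 * ‖u - v‖ ^ 2) - M * ‖toH (u - v)‖ ^ 2 ≤ (Φ u - Φ v) (u - v))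
    (u v : H10 Ω) (f : Hm1 Ω) :
    2 * (f - A (u - v) - B (u - v) - (Φ u - Φ v)) (u - v) ≤
      -(α / 2) * ‖u - v‖ ^ 2 + 2 / α * ‖f‖ ^ 2 +
        (2 * (α + S ^ 2 / (α / 4) ^ 3 + M)) * ‖toH (u - v)‖ ^ 2 := by
  have hΦ' := hΦ u v
  set w := u - v
  have h1 := hA w
  have h2 := (abs_le.1 (le_add_of_sq_le_mul (show 0 < α / 4 by positivity) hS
    (norm_nonneg (toH w)) (norm_nonneg (grad w)) (hB w))).1
  have h3 : f w ≤ α / 4 * ‖w‖ ^ 2 + 1 / α * ‖f‖ ^ 2 := by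
    have h4 := (le_abs_self _).trans (f.le_opNorm w)
    have e : α / 4 * ‖w‖ ^ 2 + 1 / α * ‖f‖ ^ 2 - ‖f‖ * ‖w‖ =
        1 / α * (α / 2 * ‖w‖ - ‖f‖) ^ 2 := by
      field_simp; ring
    have : 0 ≤ 1 / α * (α / 2 * ‖w‖ - ‖f‖) ^ 2 := by positivity
    linarith
  have e : (f - A w - B w - (Φ u - Φ v)) w = f w - A w w - B w w - (Φ u - Φ v) w := rfl
  have e2 : 2 / α * ‖f‖ ^ 2 = 2 * (1 / α * ‖f‖ ^ 2) := by ring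
  have hn := norm_sq_eq w
  rw [e, e2]
  -- Writing `‖grad w‖² = ‖w‖² - ‖toH w‖²`, diffusion supplies `α ‖w‖²`; the potential, `Φ` and `f`
  -- use at most `α / 4` each. Twice the remaining quarter is the `α / 2` of the claim.
  nlinarith

set_option maxHeartbeats 1000000 in
theorem exists_coercivity_constant (hΩ : IsBoundedLipschitzDomain Ω) (hT : 0 < T) {amin : ℝ}
    (hamin : 0 < amin) {Φ : H10 Ω → Hm1 Ω}
    (hΦ : IsLipschitzNonlinearity Φ ∨ IsMonotoneType Φ) (ρ : ℝ) :
    ∃ C : ℝ, 0 < C ∧ ∀ θ ∈ paramSet Ω amin, ‖θ.c‖ ≤ ρ → ∀ (u v : StateSpace Ω T)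
      (y z : DualStateSpace Ω T × L2 Ω), IsPDEValue Φ θ u y → IsPDEValue Φ θ v z →
        ‖u - v‖ ≤ C * ‖y - z‖ := by
  obtain ⟨M, hM0, hM⟩ := exists_lower_bound hΦ (show 0 < amin / 4 by positivity)
  obtain ⟨K, hK0, hK⟩ := exists_potential hΩ.isOpen
  set S : ℝ := ρ ^ 2 * K
  have hS0 : 0 ≤ S := by positivity
  set κ : ℝ := 2 * (amin + S ^ 2 / (amin / 4) ^ 3 + M)
  have hκ0 : 0 ≤ κ := by positivity
  -- Gronwall bounds `(amin / 2) ‖u - v‖²` by `(‖W 0‖² + (2 / amin) ‖y.1 - z.1‖²) exp(κT)`. The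
  -- product carries the maximum norm, so both terms are controlled by `‖y - z‖²`.
  set D : ℝ := 2 / amin * ((1 + 2 / amin) * Real.exp (κ * T))
  have hD0 : 0 < D := by positivity
  refine ⟨Real.sqrt D, Real.sqrt_pos.2 hD0, fun θ hθ hc u v y z hy hz => ?_⟩
  obtain ⟨A, hA⟩ := exists_diffusion hΩ θ
  obtain ⟨B, hB, hB2⟩ := hK θ.c
  obtain ⟨w', hw', hae, hinit⟩ := hy.exists_sub hA hB hz
  obtain ⟨W, hWc, hW, hen⟩ := hw'.exists_representative hΩ.isOpen hT
  have hW0 : W 0 = z.2 - y.2 := HasInitialValue.unique hT ⟨W, hWc, hW, rfl⟩ hinit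
  have hest := integral_le_of_energy (g := fun t => ‖W t‖ ^ 2)
    (e := fun t => 2 * w' t ((u - v) t)) (n := fun t => ‖(u - v) t‖ ^ 2)
    (s := fun t => ‖(y.1 - z.1) t‖ ^ 2) (α := amin / 2) (β := 2 / amin) (κ := κ) hT
    (by positivity) (by positivity) hκ0 (hWc.norm.pow 2) (fun _ => sq_nonneg _)
    (fun _ => sq_nonneg _) (fun _ => sq_nonneg _) (integrable_dual_pairing (u - v) w')
    (integrable_norm_sq (u - v)) (integrable_norm_sq (y.1 - z.1)) hen (by
      filter_upwards [hae, hW] with t ht hWt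
      rw [ht.1] at hWt
      rw [ht.1, ht.2, hWt]
      refine dual_pairing_le hamin hS0 (fun w => (hA w).lower_bound hθ) (fun w => ?_) hM _ _ _
      refine (hB2 w).trans ?_
      calc ‖θ.c‖ ^ 2 * (K * ‖toH w‖ * ‖grad w‖ ^ 3) ≤ ρ ^ 2 * (K * ‖toH w‖ * ‖grad w‖ ^ 3) := by
            gcongr
        _ = _ := by simp only [S]; ring)
  rw [← Lp_norm_sq_eq_integral (u - v), ← Lp_norm_sq_eq_integral (y.1 - z.1), hW0] at hest
  have h1 : ‖y.1 - z.1‖ ≤ ‖y - z‖ := norm_fst_le (y - z)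
  have h2 : ‖z.2 - y.2‖ ≤ ‖y - z‖ := by
    rw [norm_sub_rev]; exact norm_snd_le (y - z)
  have h3 : ‖z.2 - y.2‖ ^ 2 + 2 / amin * ‖y.1 - z.1‖ ^ 2 ≤ (1 + 2 / amin) * ‖y - z‖ ^ 2 := by
    calc ‖z.2 - y.2‖ ^ 2 + 2 / amin * ‖y.1 - z.1‖ ^ 2
        ≤ ‖y - z‖ ^ 2 + 2 / amin * ‖y - z‖ ^ 2 := by gcongr
      _ = _ := by ring
  have h4 := hest.trans (mul_le_mul_of_nonneg_right h3 (Real.exp_pos _).le)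
  have h5 : ‖u - v‖ ^ 2 ≤ D * ‖y - z‖ ^ 2 := by
    calc ‖u - v‖ ^ 2 = 2 / amin * (amin / 2 * ‖u - v‖ ^ 2) := by field_simp
      _ ≤ 2 / amin * ((1 + 2 / amin) * ‖y - z‖ ^ 2 * Real.exp (κ * T)) := by gcongr
      _ = _ := by simp only [D]; ring
  refine le_of_sq_le_sq ?_ (mul_nonneg (Real.sqrt_nonneg _) (norm_nonneg _))
  rw [mul_pow, Real.sq_sqrt hD0.le]
  exact h5

end Coercivity

end ParabolicModel

theorem mainTheorem5 (Ω : Set ParabolicModel.E3) (hΩ : ParabolicModel.IsBoundedLipschitzDomain Ω)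
    (T : ℝ) (hT : 0 < T) (amin : ℝ) (hamin : 0 < amin)
    (Φ : ParabolicModel.H10 Ω → ParabolicModel.Hm1 Ω)
    (hNem : ParabolicModel.InducesNemytskii T Φ)
    (hΦ : ParabolicModel.IsLipschitzNonlinearity Φ ∨ ParabolicModel.IsMonotoneType Φ)
    (θd : ParabolicModel.Param Ω) (hθd : θd ∈ ParabolicModel.paramSet Ω amin) (R : ℝ) :
    (∀ θ ∈ ParabolicModel.paramSet Ω amin, ∀ u ∈ ParabolicModel.smoothStates Ω T,
      ∀ y, ParabolicModel.IsPDEValue Φ θ u y ↔ y = ParabolicModel.pdeMap Φ θ u) ∧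
    ∃ C : ℝ, 0 < C ∧
      ∀ θ ∈ ParabolicModel.paramSet Ω amin ∩ Metric.closedBall θd R,
        ∀ u ∈ ParabolicModel.smoothStates Ω T, ∀ v ∈ ParabolicModel.smoothStates Ω T,
          ‖u - v‖ ≤ C * ‖ParabolicModel.pdeMap Φ θ u - ParabolicModel.pdeMap Φ θ v‖ := by
  obtain ⟨C, hC0, hC⟩ := ParabolicModel.exists_coercivity_constant hΩ hT hamin hΦ
    (‖θd.c‖ + R)
  exact ⟨fun θ _ u hu y => ParabolicModel.isPDEValue_iff hΩ hT hNem θ hu y, C, hC0,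
    fun θ hθ u hu v hv => hC θ hθ.1 (ParabolicModel.norm_c_le hθ.2) u v _ _
      ((ParabolicModel.isPDEValue_iff hΩ hT hNem θ hu _).2 rfl)
      ((ParabolicModel.isPDEValue_iff hΩ hT hNem θ hv _).2 rfl)⟩
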